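/- **Model.** A server serves $N$ users in slots $t=0,1,2,\dots$. User $n$ has weight $\beta_n\ge 0$, integer relative deadline $\tau_n\ge 1$, and prediction window $D_n\ge 0$; in each slot he has $a_{\max}$ potential packets, each of which arrives or not. For each slot a prediction says which potential packets will arrive; prediction patterns are i.i.d. over slots and independent across users. Given the prediction pattern of a slot, each packet predicted to arrive arrives with probability $p_n$ and each other packet arrives (is missed) with probability $q_n$, where $0\le q_n<p_n\le 1$; actual arrivals are i.i.d. over slots and independent across users. The prediction for slot $u$ is known from slot $u-D_n$ on, and the actual arrivals of slot $u$ are revealed at slot $u$. Let $a_n$ be the mean number of actual arrivals per slot and $\tilde a_n=\frac{a_n-a_{\max}q_n}{p_n-q_n}$ the rate of predicted arrivals. The channels of the users are independent, irreducible Markov chains on a common finite state space. Resource levels lie in a bounded set $\mathcal E\subseteq[0,\infty)$ with $0\in\mathcal E$. Transmitting a packet of user $n$ at level $e$ in channel state $i$ consumes $e$ and succeeds with probability $\zeta_n(i,e)\in[0,1]$, where $\zeta_n(i,0)=0$, $\zeta_n(i,\cdot)$ is strictly increasing and concave on $\mathcal E$, and for each $n$ the channel states are totally ordered by $\zeta_n(i,\cdot)$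 (pointwise in $e$); $i_n^{\min}$ and $i_n^{\max}$ are a worst and a best state. A packet arriving at slot $u$ can be transmitted in slots $u,\dots,u+\tau_n-1$; a predicted packet can moreover be transmitted in slots $u-D_n,\dots,u-1$ (pre-service), and then counts as delivered, at slot $u$, only if it really arrives. Any number of packets can be transmitted in a slot. A policy chooses in each slot, possibly at random and depending on the whole observed past, a level for each present or predicted undelivered packet. Let $x_n$ be the timely-throughput (long-run average expected number of timely delivered packets per slot) of user $n$, and $E_{av}$ the long-run average expected resource expenditure per slot. Let $\phi^*_I$ be the maximum (supremum) of $\sum_n\beta_nx_n$ over all policies for which these limits exist and $E_{av}\le B$, where $B>0$; let $\phi^*_0$ be the same quantity for the system without prediction (all $D_n=0$). The initial states of the two systems are arbitrary. **Bounds.** For $\lambda\ge0$ write $\zeta=\zeta_n(i_n^{\min},e)$, $\bar\zeta=\zeta_n(i_n^{\max},e)$. Maxima over $e$ are suprema over $\mathcal E$, or over $\{e\in\mathcal E:e>0\}$ where $e>0$ is written (and then $0$ if this set is empty). For $\tau\ge0$ put $$V_n^l(\tau)=\max_{e>0}\frac{1-(1-\zeta)^\tau}{\zeta}\,[-\lambda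 e+\zeta\beta_n],\qquad V_n^u(\tau)=\sum_{z=1}^{\tau}\max_e\{-\lambda e+\bar\zeta(\beta_n-\max\{0,V_n^l(z-1)\})\}.$$ Put $\tilde V_n^l(\tau)=V_n^l(\tau)$ for $\tau<\tau_n$, and for $\tau\ge\tau_n$ $$\tilde V_n^l(\tau)=\max_{e>0}\Big\{-(1-p_n)\frac{1-(1-\zeta)^{\tau-\tau_n}}{\zeta}\lambda e+p_n\frac{1-(1-\zeta)^{\tau}}{\zeta}[-\lambda e+\zeta\beta_n]\Big\},$$ $$\tilde V_n^u(\tau)=\sum_{z=\tau_n+1}^{\tau}\max_e\{-\lambda e+\bar\zeta(p_n\beta_n-\max\{0,\tilde V_n^l(\tau_n),\tilde V_n^l(z-1)\})\}+p_n\sum_{z=1}^{\tau_n}\max_e\{-\lambda e+\bar\zeta(\beta_n-\max\{0,\tilde V_n^l(z-1)\})\}.$$ Define $$g_0^l(\lambda)=\lambda B+\sum_n a_n\max\{0,V_n^l(\tau_n)\},\qquad g_0^u(\lambda)=\lambda B+\sum_n a_n\min\{\beta_n,V_n^u(\tau_n)\},$$ $$g_I^l(\lambda)=\lambda B+\sum_n\big\{\tilde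 a_n\max[0,\tilde V_n^l(\tau_n),\tilde V_n^l(\tau_n+D_n)]+(a_{\max}-\tilde a_n)q_n\max[0,V_n^l(\tau_n)]\big\},$$ $$g_I^u(\lambda)=\lambda B+\sum_n\big\{\tilde a_n\min[p_n\beta_n,\tilde V_n^u(\tau_n+D_n)]+(a_{\max}-\tilde a_n)q_n\min[\beta_n,V_n^u(\tau_n)]\big\}.$$ **Theorem.** Let $\lambda_0^*$ be a minimizer of $g_0^l$ and $\lambda_I^*$ a minimizer of $g_I^l$ over $\lambda\ge0$. Then $$g_I^l(\lambda_I^*)-g_0^u(\lambda_I^*)\le\phi_I^*-\phi_0^*\le g_I^u(\lambda_0^*)-g_0^l(\lambda_0^*).$$ -/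

import Mathlib

open Filter Topology

noncomputable section

/-! ### Elementary probability on discrete types -/

/-- Expectation of a real function under a discrete probability law. -/
def pmfMean {α : Type} (μ : PMF α) (f : α → ℝ) : ℝ := ∑' a, (μ a).toReal * f a

/-- The law on `Bool` giving probability `r` to `true`. -/
def coinLaw (r : ℝ) (h : r ∈ Set.Icc (0 : ℝ) 1) : PMF Bool :=
  PMF.ofFintype (fun b => if b then ENNReal.ofReal r else ENNReal.ofReal (1 - r)) (by
    have h1 : (0 : ℝ) ≤ 1 - r := by linarith [h.2]
    simp [← ENNReal.ofReal_add h.1 h1])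

/-- The law of a family of independent random variables with given marginal laws. -/
def indepLaw {ι : Type} [Fintype ι] [DecidableEq ι] {α : ι → Type} [∀ i, Fintype (α i)]
    (μ : (i : ι) → PMF (α i)) : PMF ((i : ι) → α i) :=
  PMF.ofFintype (fun x => ∏ i, μ i (x i)) (by
    rw [← Fintype.prod_sum (fun i a => μ i a)]
    refine Finset.prod_eq_one fun i _ => ?_
    have h := (μ i).tsum_coe
    rwa [tsum_fintype] at h)

/-- Number of entries equal to `true`. -/
def numTrue {m : ℕ} (y : Fin m → Bool) : ℝ := ∑ k, if y k then 1 else 0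

/-! ### The system -/

/-- A single server with `N` users, `K` channel states, hard deadlines, and imperfect predictions.
In each slot every user has `Amax` potential packets. A prediction says, for each of them, whether
it will arrive (`true`) or not (`false`). The prediction patterns are i.i.d. over time and
independent across users, with law `pred n`; given the pattern `y`, the pattern of actual
arrivals has law `truth n y`. -/
structure PredictiveSystem (N K : ℕ) where
  /-- there is at least one channel state -/
  chan_pos : 0 < K
  /-- maximal number of arrivals of a user in a slot -/
  Amax : ℕ
  /-- relative deadlines of the packets -/
  deadline : Fin N → ℕ
  deadline_pos : ∀ n, 0 < deadline n
  /-- lengths of the prediction windows -/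
  window : Fin N → ℕ
  /-- weights of the users -/
  β : Fin N → ℝ
  β_nonneg : ∀ n, 0 ≤ β n
  /-- available resource consumption levels; `0` means no transmission -/
  levels : Set ℝ
  levels_nonneg : ∀ e ∈ levels, 0 ≤ e
  levels_bdd : BddAbove levels
  zero_mem : (0 : ℝ) ∈ levels
  /-- success probability of a transmission, by user, channel state and level -/
  ζ : Fin N → Fin K → ℝ → ℝ
  ζ_mem : ∀ n i, ∀ e ∈ levels, ζ n i e ∈ Set.Icc (0 : ℝ) 1
  ζ_zero : ∀ n i, ζ n i 0 = 0
  ζ_strictMono : ∀ n i, StrictMonoOn (ζ n i) levels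
  /-- concavity on the (not necessarily convex) set of levels: chord slopes decrease -/
  ζ_concave : ∀ n i, ∀ e₁ ∈ levels, ∀ e₂ ∈ levels, ∀ e₃ ∈ levels, e₁ < e₂ → e₂ < e₃ →
    (ζ n i e₃ - ζ n i e₂) * (e₂ - e₁) ≤ (ζ n i e₂ - ζ n i e₁) * (e₃ - e₂)
  /-- the channel states are totally ordered by quality -/
  ζ_total : ∀ n i j,
    (∀ e ∈ levels, ζ n i e ≤ ζ n j e) ∨ (∀ e ∈ levels, ζ n j e ≤ ζ n i e)
  /-- transition law of the channel of each user -/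
  P : Fin N → Fin K → PMF (Fin K)
  /-- ergodicity: every channel state can be reached from every other one -/
  P_ergodic : ∀ n i j, Relation.ReflTransGen (fun a b => P n a b ≠ 0) i j
  /-- true-positive rate -/
  p : Fin N → ℝ
  /-- false-negative rate -/
  q : Fin N → ℝ
  q_nonneg : ∀ n, 0 ≤ q n
  q_lt_p : ∀ n, q n < p n
  p_le_one : ∀ n, p n ≤ 1
  /-- law of the prediction pattern for one slot -/
  pred : Fin N → PMF (Fin Amax → Bool)
  /-- law of the actual arrivals of a slot, given the prediction pattern -/
  truth : Fin N → (Fin Amax → Bool) → PMF (Fin Amax → Bool)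
  /-- a predicted packet arrives with probability `p`, an unpredicted one with probability `q` -/
  truth_marginal : ∀ n y k,
    pmfMean (truth n y) (fun z => if z k then 1 else 0) = if y k then p n else q n
  /-- average resource budget -/
  budget : ℝ
  budget_pos : 0 < budget

namespace PredictiveSystem

variable {N K : ℕ} (M : PredictiveSystem N K)

/-! ### The constrained Markov decision process

Everything is parametrized by the window lengths `D`: the system with prediction has
`D = M.window`, the system without prediction has `D = 0`. -/

/-- The state of the system: the channel states, and for each user `n` a table of packets. The
entry `(j, k)` is the `k`-th (potential) packet whose time to deadline is `j + 1`. For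
`j < deadline n` the packet belongs to the current or a past slot, and `present` says whether it
really arrived. For larger `j` it belongs to a future slot, and `present` says whether it is
predicted. `delivered` is the reception status. -/
structure State (D : Fin N → ℕ) where
  chan : Fin N → Fin K
  present : (n : Fin N) → Fin (M.deadline n + D n) → Fin M.Amax → Bool
  delivered : (n : Fin N) → Fin (M.deadline n + D n) → Fin M.Amax → Bool

/-- An action chooses a resource level for each packet. -/
abbrev Action (D : Fin N → ℕ) : Type :=
  (n : Fin N) → Fin (M.deadline n + D n) → Fin M.Amax → M.levels

/-- The outcome of a slot: which packets were successfully transmitted. -/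
abbrev Outcome (D : Fin N → ℕ) : Type :=
  (n : Fin N) → Fin (M.deadline n + D n) → Fin M.Amax → Bool

variable {M} {D : Fin N → ℕ}

/-- The packet can be transmitted: it has arrived or is predicted, and is still at the source. -/
def State.pending (x : M.State D) (n : Fin N) (j : Fin (M.deadline n + D n))
    (k : Fin M.Amax) : Bool :=
  x.present n j k && !x.delivered n j k

/-- Law of the outcome: transmissions of pending packets succeed independently, with probabilities
given by the channel state and the chosen level. -/
def outcomeLaw (x : M.State D) (a : M.Action D) : PMF (M.Outcome D) :=
  indepLaw fun n => indepLaw fun j => indepLaw fun k =>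
    if x.pending n j k then
      coinLaw (M.ζ n (x.chan n) (a n j k)) (M.ζ_mem n (x.chan n) (a n j k) (a n j k).2)
    else PMF.pure false

/-- One slot later: every packet is one slot closer to its deadline, packets reaching the deadline
are discarded, and a fresh prediction pattern `y` enters the window. -/
def shiftPresent (x : M.State D) (y : Fin N → Fin M.Amax → Bool) (n : Fin N)
    (j : Fin (M.deadline n + D n)) (k : Fin M.Amax) : Bool :=
  if h : j.1 + 1 < M.deadline n + D n then x.present n ⟨j.1 + 1, h⟩ k else y n k

/-- The reception statuses one slot later, after the outcome `w`. -/
def shiftDelivered (x : M.State D) (w : M.Outcome D) (n : Fin N)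
    (j : Fin (M.deadline n + D n)) (k : Fin M.Amax) : Bool :=
  if h : j.1 + 1 < M.deadline n + D n then
    x.delivered n ⟨j.1 + 1, h⟩ k || w n ⟨j.1 + 1, h⟩ k
  else false

/-- The table position of the packets of the current slot (time to deadline `deadline n`). -/
def current (M : PredictiveSystem N K) (D : Fin N → ℕ) (n : Fin N) :
    Fin (M.deadline n + D n) :=
  ⟨M.deadline n - 1, by have := M.deadline_pos n; omega⟩

/-- Transition law, given state and outcome. The channels move independently, fresh predictions
enter, and for the slot that becomes the current one the actual arrivals `z` are revealed, which
replace the prediction pattern. -/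
def nextLaw (x : M.State D) (w : M.Outcome D) : PMF (M.State D) :=
  (indepLaw fun n => M.P n (x.chan n)).bind fun s =>
  (indepLaw M.pred).bind fun y =>
  (indepLaw fun n => M.truth n (shiftPresent x y n (current M D n))).map fun z =>
    { chan := s
      present := fun n j k => if j = current M D n then z n k else shiftPresent x y n j k
      delivered := shiftDelivered x w }

/-- One recorded slot: state, action, outcome. -/
abbrev Step (M : PredictiveSystem N K) (D : Fin N → ℕ) : Type :=
  M.State D × M.Action D × M.Outcome D

/-- A randomized scheduling policy: the law of the action given the past slots (most recent first)
and the present state. -/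
abbrev Policy (M : PredictiveSystem N K) (D : Fin N → ℕ) : Type :=
  List (M.Step D) → M.State D → PMF (M.Action D)

/-- Given the history and the state at the beginning of a slot, the law of the history together
with the record of this slot. -/
def playSlot (π : M.Policy D) (hx : List (M.Step D) × M.State D) :
    PMF (List (M.Step D) × M.Step D) :=
  (π hx.1 hx.2).bind fun a => (outcomeLaw hx.2 a).map fun w => (hx.1, (hx.2, a, w))

/-- Law of history and state at the beginning of slot `t`, from an initial law of the state. -/
def historyLaw (init : PMF (M.State D)) (π : M.Policy D) :
    ℕ → PMF (List (M.Step D) × M.State D)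
  | 0 => init.map fun x => ([], x)
  | t + 1 => ((historyLaw init π t).bind (playSlot π)).bind fun r =>
      (nextLaw r.2.1 r.2.2.2).map fun x => (r.2 :: r.1, x)

/-- Law of the record (state, action, outcome) of slot `t`. -/
def slotLaw (init : PMF (M.State D)) (π : M.Policy D) (t : ℕ) : PMF (M.Step D) :=
  ((historyLaw init π t).bind (playSlot π)).map Prod.snd

/-- Number of packets of user `n` that timely reach their destination in a slot: arrived packets
transmitted successfully in it, and packets really arriving in it that were pre-served. -/
def deliveries (n : Fin N) (r : M.Step D) : ℝ :=
  (∑ j, ∑ k, if j.1 < M.deadline n ∧ r.2.2 n j k then 1 else 0) +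
  ∑ k, if r.1.present n (current M D n) k ∧ r.1.delivered n (current M D n) k then 1 else 0

/-- Resource consumed in a slot by the transmissions of packets of user `n`. -/
def consumption (n : Fin N) (r : M.Step D) : ℝ :=
  ∑ j, ∑ k, if r.1.pending n j k then ((r.2.1 n j k : M.levels) : ℝ) else 0

/-- Under the policy `π` the long-run averages exist: `x n` is the timely-throughput of user `n`
and `Eav` is the average resource expenditure. -/
structure Achieves (init : PMF (M.State D)) (π : M.Policy D) (x : Fin N → ℝ) (Eav : ℝ) :
    Prop where
  throughput : ∀ n, Tendsto (fun T : ℕ =>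
    (1 / (T : ℝ)) * ∑ t ∈ Finset.Icc 1 T, pmfMean (slotLaw init π t) (deliveries n)) atTop (𝓝 (x n))
  expenditure : Tendsto (fun T : ℕ =>
    (1 / (T : ℝ)) * ∑ t ∈ Finset.Icc 1 T, pmfMean (slotLaw init π t) (fun r => ∑ n, consumption n r))
    atTop (𝓝 Eav)

/-- The optimal weighted timely-throughput under the average resource constraint. -/
def optimalThroughput (init : PMF (M.State D)) : ℝ :=
  sSup {φ : ℝ | ∃ (π : M.Policy D) (x : Fin N → ℝ) (Eav : ℝ),
    Achieves init π x Eav ∧ Eav ≤ M.budget ∧ φ = ∑ n, M.β n * x n}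

variable (M)

/-! ### The bounds -/

/-- The arrival rate: mean number of actual arrivals of user `n` in a slot. -/
def arrivalRate (n : Fin N) : ℝ := pmfMean ((M.pred n).bind (M.truth n)) numTrue

/-- The rate of predicted arrivals, from `a = ã p + (Amax - ã) q`. -/
def predictedRate (n : Fin N) : ℝ := (M.arrivalRate n - M.Amax * M.q n) / (M.p n - M.q n)

/-- The predicted rate is indeed the mean number of predicted arrivals in a slot. -/
theorem predictedRate_eq (n : Fin N) : M.predictedRate n = pmfMean (M.pred n) numTrue := by
  have hm : ∀ y, pmfMean (M.truth n y) numTrue = M.p n * numTrue y + M.q n * (M.Amax - numTrue y) := by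
    intro y
    have h1 : pmfMean (M.truth n y) numTrue = ∑ k, if y k then M.p n else M.q n := by
      rw [← Finset.sum_congr rfl fun k _ => M.truth_marginal n y k]
      simp only [pmfMean, tsum_fintype, numTrue, Finset.mul_sum]
      rw [Finset.sum_comm]
    rw [h1]
    have h2 : (M.Amax : ℝ) = ∑ _k : Fin M.Amax, (1 : ℝ) := by simp
    rw [h2, numTrue, ← Finset.sum_sub_distrib, Finset.mul_sum, Finset.mul_sum,
      ← Finset.sum_add_distrib]
    refine Finset.sum_congr rfl fun k _ => ?_
    cases y k <;> simp
  have hsum : ∑ y, ((M.pred n) y).toReal = 1 := by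
    rw [← ENNReal.toReal_sum fun y _ => (M.pred n).apply_ne_top y, ← tsum_fintype (L := .unconditional _),
      (M.pred n).tsum_coe, ENNReal.toReal_one]
  have hb : M.arrivalRate n = ∑ y, ((M.pred n) y).toReal * pmfMean (M.truth n y) numTrue := by
    simp only [arrivalRate, pmfMean, tsum_fintype, PMF.bind_apply, Finset.mul_sum]
    rw [Finset.sum_comm]
    refine Finset.sum_congr rfl fun z _ => ?_
    rw [ENNReal.toReal_sum fun y _ =>
      ENNReal.mul_ne_top ((M.pred n).apply_ne_top y) ((M.truth n y).apply_ne_top z),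
      Finset.sum_mul]
    refine Finset.sum_congr rfl fun y _ => ?_
    rw [ENNReal.toReal_mul, mul_assoc]
  have hne : M.p n - M.q n ≠ 0 := sub_ne_zero.mpr (M.q_lt_p n).ne'
  rw [predictedRate, div_eq_iff hne, hb]
  simp only [hm]
  have he : pmfMean (M.pred n) numTrue = ∑ y, ((M.pred n) y).toReal * numTrue y := by
    simp only [pmfMean, tsum_fintype]
  have hs : ∑ y, ((M.pred n) y).toReal * (M.p n * numTrue y + M.q n * (M.Amax - numTrue y)) =
      (M.p n - M.q n) * ∑ y, ((M.pred n) y).toReal * numTrue y +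
        M.q n * M.Amax * ∑ y, ((M.pred n) y).toReal := by
    rw [Finset.mul_sum, Finset.mul_sum, ← Finset.sum_add_distrib]
    exact Finset.sum_congr rfl fun y _ => by ring
  rw [hs, hsum, he]
  ring

theorem exists_worst (n : Fin N) :
    ∃ i, ∀ j, ∀ e ∈ M.levels, M.ζ n i e ≤ M.ζ n j e := by
  have : Nonempty (Fin K) := ⟨⟨0, M.chan_pos⟩⟩
  let r : Fin K → Fin K → Prop := fun i j => ∀ e ∈ M.levels, M.ζ n j e ≤ M.ζ n i e
  have : IsTrans (Fin K) r := ⟨fun a b c h1 h2 e he => (h2 e he).trans (h1 e he)⟩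
  have hd : Directed r (id : Fin K → Fin K) := fun i j => by
    rcases M.ζ_total n i j with h | h
    · exact ⟨i, fun e _ => le_rfl, h⟩
    · exact ⟨j, h, fun e _ => le_rfl⟩
  obtain ⟨i, hi⟩ := hd.finite_le (fun j : Fin K => j)
  exact ⟨i, hi⟩

theorem exists_best (n : Fin N) :
    ∃ i, ∀ j, ∀ e ∈ M.levels, M.ζ n j e ≤ M.ζ n i e := by
  have : Nonempty (Fin K) := ⟨⟨0, M.chan_pos⟩⟩
  let r : Fin K → Fin K → Prop := fun i j => ∀ e ∈ M.levels, M.ζ n i e ≤ M.ζ n j e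
  have : IsTrans (Fin K) r := ⟨fun a b c h1 h2 e he => (h1 e he).trans (h2 e he)⟩
  have hd : Directed r (id : Fin K → Fin K) := fun i j => by
    rcases M.ζ_total n i j with h | h
    · exact ⟨j, h, fun e _ => le_rfl⟩
    · exact ⟨i, fun e _ => le_rfl, h⟩
  obtain ⟨i, hi⟩ := hd.finite_le (fun j : Fin K => j)
  exact ⟨i, hi⟩

/-- A worst channel state of user `n`. -/
def iMin (n : Fin N) : Fin K := Classical.choose (M.exists_worst n)

/-- A best channel state of user `n`. -/
def iMax (n : Fin N) : Fin K := Classical.choose (M.exists_best n)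

/-- Maximum (as a supremum) over all levels. -/
def maxLevel (f : ℝ → ℝ) : ℝ := sSup (f '' M.levels)

/-- Maximum (as a supremum) over all positive levels. -/
def maxPosLevel (f : ℝ → ℝ) : ℝ := sSup (f '' {e ∈ M.levels | 0 < e})

/-- Lower bound for the value of an actual packet. -/
def Vl (n : Fin N) (lam : ℝ) (τ : ℕ) : ℝ :=
  M.maxPosLevel fun e =>
    (1 - (1 - M.ζ n (M.iMin n) e) ^ τ) / M.ζ n (M.iMin n) e *
      (-lam * e + M.ζ n (M.iMin n) e * M.β n)

/-- Upper bound for the value of an actual packet. -/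
def Vu (n : Fin N) (lam : ℝ) (τ : ℕ) : ℝ :=
  ∑ z ∈ Finset.Icc 1 τ, M.maxLevel fun e =>
    -lam * e + M.ζ n (M.iMax n) e * (M.β n - max 0 (M.Vl n lam (z - 1)))

/-- Lower bound for the value of a predicted packet. -/
def VlPred (n : Fin N) (lam : ℝ) (τ : ℕ) : ℝ :=
  if τ < M.deadline n then M.Vl n lam τ
  else M.maxPosLevel fun e =>
    -(1 - M.p n) *
        ((1 - (1 - M.ζ n (M.iMin n) e) ^ (τ - M.deadline n)) / M.ζ n (M.iMin n) e) * lam * e +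
      M.p n * ((1 - (1 - M.ζ n (M.iMin n) e) ^ τ) / M.ζ n (M.iMin n) e) *
        (-lam * e + M.ζ n (M.iMin n) e * M.β n)

/-- Upper bound for the value of a predicted packet. -/
def VuPred (n : Fin N) (lam : ℝ) (τ : ℕ) : ℝ :=
  if τ < M.deadline n then M.Vu n lam τ
  else
    (∑ z ∈ Finset.Icc (M.deadline n + 1) τ, M.maxLevel fun e =>
      -lam * e + M.ζ n (M.iMax n) e *
        (M.p n * M.β n -
          max 0 (max (M.VlPred n lam (M.deadline n)) (M.VlPred n lam (z - 1))))) +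
    M.p n * ∑ z ∈ Finset.Icc 1 (M.deadline n), M.maxLevel fun e =>
      -lam * e + M.ζ n (M.iMax n) e * (M.β n - max 0 (M.VlPred n lam (z - 1)))

/-- Lower dual function without prediction. -/
def g0l (lam : ℝ) : ℝ :=
  lam * M.budget + ∑ n, M.arrivalRate n * max 0 (M.Vl n lam (M.deadline n))

/-- Upper dual function without prediction. -/
def g0u (lam : ℝ) : ℝ :=
  lam * M.budget + ∑ n, M.arrivalRate n * min (M.β n) (M.Vu n lam (M.deadline n))

/-- Lower dual function with imperfect prediction. -/
def gIl (lam : ℝ) : ℝ :=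
  lam * M.budget + ∑ n,
    (M.predictedRate n * max 0 (max (M.VlPred n lam (M.deadline n))
        (M.VlPred n lam (M.deadline n + M.window n))) +
      (M.Amax - M.predictedRate n) * M.q n * max 0 (M.Vl n lam (M.deadline n)))

/-- Upper dual function with imperfect prediction. -/
def gIu (lam : ℝ) : ℝ :=
  lam * M.budget + ∑ n,
    (M.predictedRate n * min (M.p n * M.β n) (M.VuPred n lam (M.deadline n + M.window n)) +
      (M.Amax - M.predictedRate n) * M.q n * min (M.β n) (M.Vu n lam (M.deadline n)))

end PredictiveSystem

end

/-! For arbitrary window lengths `D`, the optimal throughput is at most `gu D lam` for every `lam ≥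
0`, and at least `gl D` at a minimizer of `gl D`. Taking `D = M.window` and `D = 0` and subtracting
gives the theorem; each system's upper bound is evaluated at the minimizer belonging to the other
one.

Pricing. Any number of packets may be sent in a slot, so once the resource costs `lam` per unit the
packets decouple. Each is a finite-horizon dynamic program driven by the channel of its user, with
values `val` (arrived) and `valPred` (predicted). Sending at a constant level through the worst
channel bounds these values from below; bounding each step of the recursion by the best channel,
with the lower bound in place of the value of waiting, bounds them from above.

Drift. The sum `statePot` of the packet values is a potential. By `mean_slot` and the Bellman
equation, net gain plus mean next potential is at most the current potential plus the value of the
fresh entries, for every policy; the reverse holds up to a small error for a nearly greedy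
stationary policy. The potential is bounded, so it telescopes away in the time averages. This bounds
the Lagrangian, throughput minus `lam` times expenditure.

Duality. The upper bound is weak duality (`Achieves.le_gu`). For the lower bound, randomizing
between two policies makes the achievable pairs convex (`exists_mixed_policy`), and never
transmitting is a Slater point, so a multiplier `l` exists (`exists_multiplier`). The nearly greedy
policy at price `l` has long-run averages by the mean ergodic theorem on the finite state space,
whence `gl D l` is at most the optimum; a minimizer of `gl D` only lowers the left side. -/

open scoped ENNReal

noncomputable section

/-! ### Calculus of expectations -/

section Mean

variable {α β : Type}

/-- The function is bounded. -/
def IsBdd (f : α → ℝ) : Prop := ∃ C, ∀ a, |f a| ≤ C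

theorem IsBdd.of_finite [Finite α] (f : α → ℝ) : IsBdd f := by
  obtain ⟨C, hC⟩ := (Set.finite_range fun a => |f a|).bddAbove
  exact ⟨C, fun a => hC ⟨a, rfl⟩⟩

theorem IsBdd.add {f g : α → ℝ} (hf : IsBdd f) (hg : IsBdd g) : IsBdd fun a => f a + g a := by
  obtain ⟨C, hC⟩ := hf
  obtain ⟨C', hC'⟩ := hg
  exact ⟨C + C', fun a => (abs_add_le _ _).trans (add_le_add (hC a) (hC' a))⟩

theorem IsBdd.const_mul {f : α → ℝ} (c : ℝ) (hf : IsBdd f) : IsBdd fun a => c * f a := by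
  obtain ⟨C, hC⟩ := hf
  exact ⟨|c| * C, fun a => by
    rw [abs_mul]; exact mul_le_mul_of_nonneg_left (hC a) (abs_nonneg c)⟩

theorem IsBdd.sum {ι : Type*} {s : Finset ι} {f : ι → α → ℝ} (hf : ∀ i ∈ s, IsBdd (f i)) :
    IsBdd fun a => ∑ i ∈ s, f i a := by
  classical
  induction s using Finset.induction_on with
  | empty => exact ⟨0, by simp⟩
  | insert i s hi ih =>
    simp only [Finset.sum_insert hi]
    exact (hf i (by simp)).add (ih fun j hj => hf j (by simp [hj]))

theorem IsBdd.comp {f : α → ℝ} (hf : IsBdd f) (g : β → α) : IsBdd fun b => f (g b) := by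
  obtain ⟨C, hC⟩ := hf
  exact ⟨C, fun b => hC (g b)⟩

theorem summable_mass (μ : PMF α) : Summable fun a => (μ a).toReal :=
  ENNReal.summable_toReal (by rw [μ.tsum_coe]; simp)

theorem tsum_mass (μ : PMF α) : ∑' a, (μ a).toReal = 1 := by
  rw [← ENNReal.tsum_toReal_eq fun a => μ.apply_ne_top a, μ.tsum_coe, ENNReal.toReal_one]

/-- The set of levels may be infinite, so laws of actions and histories need not have finite
support. Boundedness is what makes the series defining `pmfMean` converge. -/
theorem summable_mass_mul (μ : PMF α) {f : α → ℝ} (hf : IsBdd f) :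
    Summable fun a => (μ a).toReal * f a := by
  obtain ⟨C, hC⟩ := hf
  refine Summable.of_norm_bounded ((summable_mass μ).mul_right C) fun a => ?_
  rw [Real.norm_eq_abs, abs_mul, abs_of_nonneg ENNReal.toReal_nonneg]
  exact mul_le_mul_of_nonneg_left (hC a) ENNReal.toReal_nonneg

theorem pmfMean_const (μ : PMF α) (c : ℝ) : pmfMean μ (fun _ => c) = c := by
  rw [pmfMean, tsum_mul_right, tsum_mass, one_mul]

theorem pmfMean_add (μ : PMF α) {f g : α → ℝ} (hf : IsBdd f) (hg : IsBdd g) :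
    pmfMean μ (fun a => f a + g a) = pmfMean μ f + pmfMean μ g := by
  simp only [pmfMean, mul_add]
  exact (summable_mass_mul μ hf).tsum_add (summable_mass_mul μ hg)

theorem pmfMean_const_mul (μ : PMF α) (c : ℝ) (f : α → ℝ) :
    pmfMean μ (fun a => c * f a) = c * pmfMean μ f := by
  simp only [pmfMean, ← tsum_mul_left]
  exact tsum_congr fun a => by ring

theorem pmfMean_sum (μ : PMF α) {ι : Type*} (s : Finset ι) {f : ι → α → ℝ}
    (hf : ∀ i ∈ s, IsBdd (f i)) :
    pmfMean μ (fun a => ∑ i ∈ s, f i a) = ∑ i ∈ s, pmfMean μ (f i) := by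
  classical
  induction s using Finset.induction_on with
  | empty => simp [pmfMean]
  | insert i s hi ih =>
    simp only [Finset.sum_insert hi]
    rw [pmfMean_add μ (hf i (by simp)) (IsBdd.sum fun j hj => hf j (by simp [hj])),
      ih fun j hj => hf j (by simp [hj])]

theorem pmfMean_mono (μ : PMF α) {f g : α → ℝ} (hf : IsBdd f) (hg : IsBdd g)
    (h : ∀ a, f a ≤ g a) : pmfMean μ f ≤ pmfMean μ g :=
  (summable_mass_mul μ hf).tsum_le_tsum
    (fun a => mul_le_mul_of_nonneg_left (h a) ENNReal.toReal_nonneg) (summable_mass_mul μ hg)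

theorem pmfMean_le (μ : PMF α) {f : α → ℝ} {C : ℝ} (hf : IsBdd f) (h : ∀ a, f a ≤ C) :
    pmfMean μ f ≤ C :=
  (pmfMean_mono μ hf ⟨|C|, fun _ => le_rfl⟩ h).trans_eq (pmfMean_const μ C)

theorem le_pmfMean (μ : PMF α) {f : α → ℝ} {C : ℝ} (hf : IsBdd f) (h : ∀ a, C ≤ f a) :
    C ≤ pmfMean μ f :=
  (pmfMean_const μ C).symm.trans_le (pmfMean_mono μ ⟨|C|, fun _ => le_rfl⟩ hf h)

theorem abs_pmfMean_le (μ : PMF α) {f : α → ℝ} {C : ℝ} (h : ∀ a, |f a| ≤ C) :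
    |pmfMean μ f| ≤ C :=
  abs_le.2 ⟨le_pmfMean μ ⟨C, h⟩ fun a => (abs_le.1 (h a)).1,
    pmfMean_le μ ⟨C, h⟩ fun a => (abs_le.1 (h a)).2⟩

theorem pmfMean_pure (a : α) (f : α → ℝ) : pmfMean (PMF.pure a) f = f a := by
  rw [pmfMean, tsum_eq_single a]
  · simp
  · intro b hb
    simp [hb]

theorem pmfMean_bind (μ : PMF α) (κ : α → PMF β) {f : β → ℝ} (hf : IsBdd f) :
    pmfMean (μ.bind κ) f = pmfMean μ fun a => pmfMean (κ a) f := by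
  obtain ⟨C, hC⟩ := hf
  have hprod : Summable fun x : α × β => (μ x.1 * κ x.1 x.2).toReal := by
    refine ENNReal.summable_toReal ?_
    rw [ENNReal.tsum_prod (f := fun a b => μ a * κ a b)]
    simp [ENNReal.tsum_mul_left, PMF.tsum_coe]
  have hs : Summable (Function.uncurry fun (a : α) (b : β) => (μ a * κ a b).toReal * f b) := by
    refine Summable.of_norm_bounded (hprod.mul_right C) ?_
    rintro ⟨a, b⟩
    rw [Function.uncurry_apply_pair, Real.norm_eq_abs, abs_mul,
      abs_of_nonneg ENNReal.toReal_nonneg]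
    exact mul_le_mul_of_nonneg_left (hC b) ENNReal.toReal_nonneg
  have h1 : pmfMean (μ.bind κ) f = ∑' b, ∑' a, (μ a * κ a b).toReal * f b := by
    refine tsum_congr fun b => ?_
    rw [PMF.bind_apply, ENNReal.tsum_toReal_eq fun a =>
      ENNReal.mul_ne_top (μ.apply_ne_top a) ((κ a).apply_ne_top b), tsum_mul_right]
  rw [h1, hs.tsum_comm]
  refine tsum_congr fun a => ?_
  simp only [pmfMean, ← tsum_mul_left]
  refine tsum_congr fun b => ?_
  rw [ENNReal.toReal_mul, mul_assoc]

theorem pmfMean_map (μ : PMF α) (g : α → β) {f : β → ℝ} (hf : IsBdd f) :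
    pmfMean (μ.map g) f = pmfMean μ fun a => f (g a) := by
  rw [PMF.map, pmfMean_bind μ _ hf]
  simp only [Function.comp, pmfMean_pure]

theorem pmfMean_coinLaw (r : ℝ) (h : r ∈ Set.Icc (0 : ℝ) 1) (f : Bool → ℝ) :
    pmfMean (coinLaw r h) f = r * f true + (1 - r) * f false := by
  have h1 : (0 : ℝ) ≤ 1 - r := by linarith [h.2]
  simp [pmfMean, coinLaw, tsum_fintype, ENNReal.toReal_ofReal h.1, ENNReal.toReal_ofReal h1]

theorem pmfMean_indepLaw {ι : Type} [Fintype ι] [DecidableEq ι] {γ : ι → Type}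
    [∀ i, Fintype (γ i)] (μ : (i : ι) → PMF (γ i)) (i₀ : ι) (f : γ i₀ → ℝ) :
    pmfMean (indepLaw μ) (fun x => f (x i₀)) = pmfMean (μ i₀) f := by
  simp only [pmfMean, tsum_fintype, indepLaw, PMF.ofFintype_apply, ENNReal.toReal_prod]
  -- Absorbing `f` into the factor at `i₀` keeps the summand a product over `i`, so the sum over `x`
  -- factorizes; every factor away from `i₀` sums to 1.
  have h1 : ∀ x : (i : ι) → γ i, (∏ i, (μ i (x i)).toReal) * f (x i₀) =
      ∏ i, ((μ i (x i)).toReal * if h : i = i₀ then f (h ▸ x i) else 1) := by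
    intro x
    rw [Finset.prod_mul_distrib]
    congr 1
    rw [Finset.prod_eq_single i₀] <;> simp +contextual
  simp only [h1]
  rw [← Fintype.prod_sum (fun i a => (μ i a).toReal * if h : i = i₀ then f (h ▸ a) else 1),
    Finset.prod_eq_single i₀]
  · simp
  · intro i _ hi
    simp only [hi, dif_neg, not_false_eq_true, mul_one]
    rw [← tsum_fintype (L := .unconditional _), tsum_mass]
  · simp

end Mean

namespace PredictiveSystem

variable {N K : ℕ} (M : PredictiveSystem N K)

/-! ### The values of a packet -/

theorem maxLevel_le {f : ℝ → ℝ} {C : ℝ} (h : ∀ e ∈ M.levels, f e ≤ C) : M.maxLevel f ≤ C :=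
  csSup_le (Set.Nonempty.image f ⟨0, M.zero_mem⟩) (by rintro _ ⟨e, he, rfl⟩; exact h e he)

theorem le_maxLevel {f : ℝ → ℝ} {C : ℝ} (h : ∀ e ∈ M.levels, f e ≤ C) {e : ℝ}
    (he : e ∈ M.levels) : f e ≤ M.maxLevel f :=
  le_csSup ⟨C, by rintro _ ⟨e, he, rfl⟩; exact h e he⟩ ⟨e, he, rfl⟩

theorem exists_level_maxLevel_sub_le (f : ℝ → ℝ) {ε : ℝ} (hε : 0 < ε) :
    ∃ e : M.levels, M.maxLevel f - ε ≤ f e := by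
  obtain ⟨_, ⟨e, he, rfl⟩, h⟩ := exists_lt_of_lt_csSup
    (Set.Nonempty.image f ⟨0, M.zero_mem⟩) (sub_lt_self (M.maxLevel f) hε)
  exact ⟨⟨e, he⟩, h.le⟩

/-- `0 ≤ C` covers the case without positive levels, where the supremum is 0 by convention. -/
theorem maxPosLevel_le {f : ℝ → ℝ} {C : ℝ} (h0 : 0 ≤ C)
    (h : ∀ e ∈ M.levels, 0 < e → f e ≤ C) : M.maxPosLevel f ≤ C :=
  Real.sSup_le (by rintro _ ⟨e, ⟨he, hpos⟩, rfl⟩; exact h e he hpos) h0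

theorem ζ_iMin_le (n : Fin N) (i : Fin K) {e : ℝ} (he : e ∈ M.levels) :
    M.ζ n (M.iMin n) e ≤ M.ζ n i e :=
  Classical.choose_spec (M.exists_worst n) i e he

theorem ζ_le_iMax (n : Fin N) (i : Fin K) {e : ℝ} (he : e ∈ M.levels) :
    M.ζ n i e ≤ M.ζ n (M.iMax n) e :=
  Classical.choose_spec (M.exists_best n) i e he

theorem ζ_pos (n : Fin N) (i : Fin K) {e : ℝ} (he : e ∈ M.levels) (hpos : 0 < e) :
    0 < M.ζ n i e :=
  (M.ζ_zero n i).symm.trans_lt (M.ζ_strictMono n i M.zero_mem he hpos)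

theorem p_nonneg (n : Fin N) : 0 ≤ M.p n := (M.q_nonneg n).trans (M.q_lt_p n).le

/-- Expected gain of sending a packet at level `e` in channel state `i`, when a success is worth
`r`, a failure is worth `f`, and a unit of the resource costs `lam`. -/
def sendGain (n : Fin N) (lam r f : ℝ) (i : Fin K) (e : ℝ) : ℝ :=
  -lam * e + M.ζ n i e * r + (1 - M.ζ n i e) * f

/-- The optimal expected gain. -/
def bestGain (n : Fin N) (lam r f : ℝ) (i : Fin K) : ℝ := M.maxLevel (M.sendGain n lam r f i)

variable {M}
variable {n : Fin N} {lam r f : ℝ}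

/-- The gain is a convex combination of `r` and `f` minus a nonnegative cost. This bound makes the
suprema over levels genuine; `f ≤ r` also makes the gain increasing in the success probability. -/
theorem sendGain_le (hlam : 0 ≤ lam) (hf : f ≤ r) (i : Fin K) :
    ∀ e ∈ M.levels, M.sendGain n lam r f i e ≤ r := by
  intro e he
  have h1 := mul_nonneg hlam (M.levels_nonneg e he)
  have h2 := mul_nonneg (sub_nonneg.2 (M.ζ_mem n i e he).2) (sub_nonneg.2 hf)
  unfold sendGain
  linarith

theorem sendGain_le_bestGain (hlam : 0 ≤ lam) (hf : f ≤ r) (i : Fin K) {e : ℝ}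
    (he : e ∈ M.levels) : M.sendGain n lam r f i e ≤ M.bestGain n lam r f i :=
  M.le_maxLevel (sendGain_le hlam hf i) he

theorem bestGain_le (hlam : 0 ≤ lam) (hf : f ≤ r) (i : Fin K) : M.bestGain n lam r f i ≤ r :=
  M.maxLevel_le (sendGain_le hlam hf i)

theorem le_bestGain (hlam : 0 ≤ lam) (hf : f ≤ r) (i : Fin K) : f ≤ M.bestGain n lam r f i := by
  have h := sendGain_le_bestGain (n := n) hlam hf i M.zero_mem
  simpa [sendGain, M.ζ_zero] using h

theorem sendGain_iMin_le_bestGain (hlam : 0 ≤ lam) (hf : f ≤ r) (i : Fin K) {e : ℝ}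
    (he : e ∈ M.levels) {g : ℝ} (hg : g ≤ f) :
    M.sendGain n lam r g (M.iMin n) e ≤ M.bestGain n lam r f i := by
  refine le_trans ?_ (sendGain_le_bestGain hlam hf i he)
  have h1 := mul_nonneg (sub_nonneg.2 (M.ζ_iMin_le n i he)) (sub_nonneg.2 hf)
  have h2 := mul_nonneg (sub_nonneg.2 (M.ζ_mem n (M.iMin n) e he).2) (sub_nonneg.2 hg)
  unfold sendGain
  linarith

/-- The gain equals `f` plus `-lam * e + ζ * (r - f)`, and the second part only grows when `ζ` is
replaced by the best channel and `f` by the smaller `g`. -/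
theorem bestGain_le_add (hlam : 0 ≤ lam) (hf : f ≤ r) (i : Fin K) {g : ℝ} (hg : g ≤ f) :
    M.bestGain n lam r f i ≤
      f + M.maxLevel fun e => -lam * e + M.ζ n (M.iMax n) e * (r - g) := by
  refine M.maxLevel_le fun e he => ?_
  have h0 := M.le_maxLevel (f := fun e => -lam * e + M.ζ n (M.iMax n) e * (r - g))
    (C := r - g) (fun e he => by
      have h1 := mul_nonneg hlam (M.levels_nonneg e he)
      have h2 := mul_nonneg (sub_nonneg.2 (M.ζ_mem n (M.iMax n) e he).2)
        (sub_nonneg.2 (hg.trans hf))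
      linarith) he
  have h1 := mul_nonneg (sub_nonneg.2 (M.ζ_le_iMax n i he)) (sub_nonneg.2 hf)
  have h2 := mul_nonneg (M.ζ_mem n (M.iMax n) e he).1 (sub_nonneg.2 hg)
  unfold sendGain
  linarith

variable (M n lam)

/-- Optimal value of an actual packet with `τ` slots left, by channel state. -/
def val : ℕ → Fin K → ℝ
  | 0 => fun _ => 0
  | τ + 1 => fun i => M.bestGain n lam (M.β n) (pmfMean (M.P n i) (val τ)) i

/-- Optimal value of a packet predicted to arrive `m` slots later. -/
def valPred : ℕ → Fin K → ℝ
  | 0 => fun i => M.p n * val M n lam (M.deadline n) i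
  | m + 1 => fun i => M.bestGain n lam (M.p n * M.β n) (pmfMean (M.P n i) (valPred m)) i

variable {lam}

theorem val_le (hlam : 0 ≤ lam) (τ : ℕ) (i : Fin K) : M.val n lam τ i ≤ M.β n := by
  induction τ generalizing i with
  | zero => exact M.β_nonneg n
  | succ τ ih => exact bestGain_le hlam (pmfMean_le _ (.of_finite _) ih) i

theorem mean_val_le (hlam : 0 ≤ lam) (τ : ℕ) (i : Fin K) :
    pmfMean (M.P n i) (M.val n lam τ) ≤ M.β n :=
  pmfMean_le _ (.of_finite _) (M.val_le n hlam τ)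

theorem valPred_le (hlam : 0 ≤ lam) (m : ℕ) (i : Fin K) :
    M.valPred n lam m i ≤ M.p n * M.β n := by
  induction m generalizing i with
  | zero => exact mul_le_mul_of_nonneg_left (M.val_le n hlam _ i) (M.p_nonneg n)
  | succ m ih => exact bestGain_le hlam (pmfMean_le _ (.of_finite _) ih) i

theorem mean_valPred_le (hlam : 0 ≤ lam) (m : ℕ) (i : Fin K) :
    pmfMean (M.P n i) (M.valPred n lam m) ≤ M.p n * M.β n :=
  pmfMean_le _ (.of_finite _) (M.valPred_le n hlam m)

theorem val_nonneg (hlam : 0 ≤ lam) (τ : ℕ) (i : Fin K) : 0 ≤ M.val n lam τ i := by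
  induction τ generalizing i with
  | zero => exact le_rfl
  | succ τ ih =>
    exact (le_pmfMean _ (.of_finite _) ih).trans (le_bestGain hlam (M.mean_val_le n hlam τ i) i)

/-- Waiting without pre-service is always allowed, so a lower bound valid at the arrival slot
propagates backwards. -/
theorem le_valPred_of_le (hlam : 0 ≤ lam) {c : ℝ}
    (hc : ∀ i, c ≤ M.p n * M.val n lam (M.deadline n) i) (m : ℕ) (i : Fin K) :
    c ≤ M.valPred n lam m i := by
  induction m generalizing i with
  | zero => exact hc i
  | succ m ih =>
    exact (le_pmfMean _ (.of_finite _) ih).trans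
      (le_bestGain hlam (M.mean_valPred_le n hlam m i) i)

/-- The quotient is the mean number of attempts until the first success, truncated at `τ` attempts;
the recursion conditions on the first attempt. -/
theorem geom_succ {z : ℝ} (hz : z ≠ 0) (τ : ℕ) :
    (1 - (1 - z) ^ (τ + 1)) / z = 1 + (1 - z) * ((1 - (1 - z) ^ τ) / z) := by
  field_simp
  ring

/-- The left side is the value of sending at level `e` until success if the channel were always in
its worst state. -/
theorem constLevel_le_val (hlam : 0 ≤ lam) {e : ℝ} (he : e ∈ M.levels) (hpos : 0 < e) (τ : ℕ)
    (i : Fin K) :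
    (1 - (1 - M.ζ n (M.iMin n) e) ^ τ) / M.ζ n (M.iMin n) e *
      (-lam * e + M.ζ n (M.iMin n) e * M.β n) ≤ M.val n lam τ i := by
  induction τ generalizing i with
  | zero => simp [val]
  | succ τ ih =>
    refine Eq.trans_le ?_ (sendGain_iMin_le_bestGain hlam (M.mean_val_le n hlam τ i) i he
      (le_pmfMean _ (.of_finite _) ih))
    rw [geom_succ (M.ζ_pos n _ he hpos).ne', sendGain]
    ring

/-- Same strategy, started `m` slots before arrival. With probability `1 - p` the packet does not
arrive and the cost of the pre-service attempts is lost; with probability `p` there are up to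
`deadline + m` useful attempts. -/
theorem constLevel_le_valPred (hlam : 0 ≤ lam) {e : ℝ} (he : e ∈ M.levels) (hpos : 0 < e) (m : ℕ)
    (i : Fin K) :
    -(1 - M.p n) * ((1 - (1 - M.ζ n (M.iMin n) e) ^ m) / M.ζ n (M.iMin n) e) * lam * e +
      M.p n * ((1 - (1 - M.ζ n (M.iMin n) e) ^ (M.deadline n + m)) / M.ζ n (M.iMin n) e) *
        (-lam * e + M.ζ n (M.iMin n) e * M.β n) ≤ M.valPred n lam m i := by
  induction m generalizing i with
  | zero =>
    refine le_trans (le_of_eq ?_) (mul_le_mul_of_nonneg_left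
      (M.constLevel_le_val n hlam he hpos (M.deadline n) i) (M.p_nonneg n))
    simp
    ring
  | succ m ih =>
    refine Eq.trans_le ?_ (sendGain_iMin_le_bestGain hlam (M.mean_valPred_le n hlam m i) i he
      (le_pmfMean _ (.of_finite _) ih))
    rw [← add_assoc, geom_succ (M.ζ_pos n _ he hpos).ne', geom_succ (M.ζ_pos n _ he hpos).ne',
      sendGain]
    ring

theorem Vl_le_val (hlam : 0 ≤ lam) (τ : ℕ) (i : Fin K) : M.Vl n lam τ ≤ M.val n lam τ i :=
  M.maxPosLevel_le (M.val_nonneg n hlam τ i) fun _ he hpos =>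
    M.constLevel_le_val n hlam he hpos τ i

theorem max_Vl_le_val (hlam : 0 ≤ lam) (τ : ℕ) (i : Fin K) :
    max 0 (M.Vl n lam τ) ≤ M.val n lam τ i :=
  max_le (M.val_nonneg n hlam τ i) (M.Vl_le_val n hlam τ i)

theorem valPred_nonneg (hlam : 0 ≤ lam) (m : ℕ) (i : Fin K) : 0 ≤ M.valPred n lam m i :=
  M.le_valPred_of_le n hlam (fun i => mul_nonneg (M.p_nonneg n) (M.val_nonneg n hlam _ i)) m i

theorem VlPred_add_le_valPred (hlam : 0 ≤ lam) (m : ℕ) (i : Fin K) :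
    M.VlPred n lam (M.deadline n + m) ≤ M.valPred n lam m i := by
  rw [VlPred, if_neg (by omega), Nat.add_sub_cancel_left]
  exact M.maxPosLevel_le (M.valPred_nonneg n hlam m i) fun e he hpos =>
    M.constLevel_le_valPred n hlam he hpos m i

theorem VlPred_deadline_le_valPred (hlam : 0 ≤ lam) (m : ℕ) (i : Fin K) :
    M.VlPred n lam (M.deadline n) ≤ M.valPred n lam m i :=
  M.le_valPred_of_le n hlam (fun i => M.VlPred_add_le_valPred n hlam 0 i) m i

theorem max_VlPred_le_valPred (hlam : 0 ≤ lam) (m : ℕ) (i : Fin K) :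
    max 0 (max (M.VlPred n lam (M.deadline n)) (M.VlPred n lam (M.deadline n + m))) ≤
      M.valPred n lam m i :=
  max_le (M.valPred_nonneg n hlam m i) (max_le (M.VlPred_deadline_le_valPred n hlam m i)
    (M.VlPred_add_le_valPred n hlam m i))

/-- Each extra slot adds to the mean value of waiting at most one summand of `Vu`, by
`bestGain_le_add` with the lower bound `max 0 Vl` as `g`. -/
theorem val_le_Vu (hlam : 0 ≤ lam) (τ : ℕ) (i : Fin K) : M.val n lam τ i ≤ M.Vu n lam τ := by
  induction τ generalizing i with
  | zero => simp [val, Vu]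
  | succ τ ih =>
    have h := bestGain_le_add (M := M) (n := n) hlam (M.mean_val_le n hlam τ i) i
      (le_pmfMean (M.P n i) (.of_finite _) (M.max_Vl_le_val n hlam τ))
    have h2 := pmfMean_le (M.P n i) (.of_finite _) ih
    rw [Vu, Finset.sum_Icc_succ_top (by omega), ← Vu, Nat.add_sub_cancel]
    exact h.trans (by linarith)

theorem val_le_min (hlam : 0 ≤ lam) (τ : ℕ) (i : Fin K) :
    M.val n lam τ i ≤ min (M.β n) (M.Vu n lam τ) :=
  le_min (M.val_le n hlam τ i) (M.val_le_Vu n hlam τ i)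

theorem VuPred_deadline : M.VuPred n lam (M.deadline n) = M.p n * M.Vu n lam (M.deadline n) := by
  rw [VuPred, if_neg (lt_irrefl _), Finset.Icc_eq_empty (by omega), Finset.sum_empty, zero_add, Vu]
  congr 1
  refine Finset.sum_congr rfl fun z hz => ?_
  rw [Finset.mem_Icc] at hz
  rw [VlPred, if_pos (by omega)]

theorem valPred_le_VuPred (hlam : 0 ≤ lam) (m : ℕ) (i : Fin K) :
    M.valPred n lam m i ≤ M.VuPred n lam (M.deadline n + m) := by
  induction m generalizing i with
  | zero =>
    rw [add_zero, VuPred_deadline]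
    exact mul_le_mul_of_nonneg_left (M.val_le_Vu n hlam _ i) (M.p_nonneg n)
  | succ m ih =>
    have h := bestGain_le_add (M := M) (n := n) hlam (M.mean_valPred_le n hlam m i) i
      (le_pmfMean (M.P n i) (.of_finite _) (M.max_VlPred_le_valPred n hlam m))
    have h2 := pmfMean_le (M.P n i) (.of_finite _) ih
    rw [VuPred, if_neg (by omega)] at h2 ⊢
    rw [← add_assoc, Finset.sum_Icc_succ_top (by omega), Nat.add_sub_cancel]
    exact h.trans (by linarith)

theorem valPred_le_min (hlam : 0 ≤ lam) (m : ℕ) (i : Fin K) :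
    M.valPred n lam m i ≤ min (M.p n * M.β n) (M.VuPred n lam (M.deadline n + m)) :=
  le_min (M.valPred_le n hlam m i) (M.valPred_le_VuPred n hlam m i)

end PredictiveSystem

namespace PredictiveSystem

variable {N K : ℕ} (M : PredictiveSystem N K)

/-! ### The potential of a packet -/

/-- Potential of a table entry in position `j`, where `c` stands for the value that a fresh packet
is credited with when its prediction is negative. -/
def pot (n : Fin N) (lam c : ℝ) (j : ℕ) (b del : Bool) (i : Fin K) : ℝ :=
  if j < M.deadline n then
    if b then (if del then (if j + 1 = M.deadline n then M.β n else 0) else M.val n lam (j + 1) i)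
    else 0
  else if b then (if del then M.p n * M.β n else M.valPred n lam (j + 1 - M.deadline n) i)
  else if del then M.q n * M.β n else M.q n * c

/-- Mean potential of an entry entering position `j`: the arrivals of the current slot are
revealed. -/
def reveal (n : Fin N) (lam c : ℝ) (j : ℕ) (b del : Bool) (i : Fin K) : ℝ :=
  if j + 1 = M.deadline n then
    (if b then M.p n else M.q n) * M.pot n lam c j true del i +
      (1 - if b then M.p n else M.q n) * M.pot n lam c j false del i
  else M.pot n lam c j b del i

/-- Mean potential of the entry of position `j` one slot later. -/
def cont (n : Fin N) (lam c : ℝ) (j : ℕ) (b del : Bool) (i : Fin K) : ℝ :=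
  if j = 0 then 0 else pmfMean (M.P n i) (M.reveal n lam c (j - 1) b del)

/-- Net gain from the entry of position `j` in a slot, at level `e` and with outcome `o`. -/
def slotGain (n : Fin N) (lam : ℝ) (j : ℕ) (b del : Bool) (e : ℝ) (o : Bool) : ℝ :=
  M.β n * ((if j < M.deadline n ∧ o then 1 else 0) +
    (if j + 1 = M.deadline n ∧ b ∧ del then 1 else 0)) - lam * (if b && !del then e else 0)

/-- Worth of a success in position `j`. -/
def succVal (n : Fin N) (j : ℕ) : ℝ := if j < M.deadline n then M.β n else M.p n * M.β n

/-- Worth of a failure in position `j`. -/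
def failVal (n : Fin N) (lam : ℝ) (j : ℕ) (i : Fin K) : ℝ :=
  pmfMean (M.P n i)
    (if j < M.deadline n then M.val n lam j else M.valPred n lam (j - M.deadline n))

variable {M} {n : Fin N} {lam c : ℝ} {j : ℕ}

theorem failVal_le_succVal (hlam : 0 ≤ lam) (j : ℕ) (i : Fin K) :
    M.failVal n lam j i ≤ M.succVal n j := by
  unfold failVal succVal
  split_ifs
  · exact M.mean_val_le n hlam j i
  · exact M.mean_valPred_le n hlam _ i

/-- This is the Bellman equation: before and after arrival alike, the potential of a pending entry
is the optimal one-step gain. -/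
theorem pot_pending (i : Fin K) :
    M.pot n lam c j true false i = M.bestGain n lam (M.succVal n j) (M.failVal n lam j i) i := by
  unfold pot failVal succVal
  by_cases h : j < M.deadline n
  · simp [h, val]
  · simp [h, Nat.sub_add_comm (not_lt.1 h), valPred]

theorem cont_eq_of_forall (hj : 0 < j) {b del : Bool} {i : Fin K} {f : Fin K → ℝ}
    (h : ∀ s, M.reveal n lam c (j - 1) b del s = f s) :
    M.cont n lam c j b del i = pmfMean (M.P n i) f := by
  rw [cont, if_neg hj.ne', funext h]

theorem reveal_past (hj : 0 < j) (h : j < M.deadline n) (b del : Bool) (i : Fin K) :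
    M.reveal n lam c (j - 1) b del i = if b && !del then M.val n lam j i else 0 := by
  have h1 : j - 1 + 1 = j := by omega
  have h2 : j - 1 < M.deadline n := by omega
  cases b <;> cases del <;> simp [reveal, pot, h1, h2, h.ne]

theorem reveal_current (b del : Bool) (i : Fin K) :
    M.reveal n lam c (M.deadline n - 1) b del i = (if b then M.p n else M.q n) *
      if del then M.β n else M.val n lam (M.deadline n) i := by
  have hd := M.deadline_pos n
  have h1 : M.deadline n - 1 + 1 = M.deadline n := by omega
  have h2 : M.deadline n - 1 < M.deadline n := by omega
  cases b <;> cases del <;> simp [reveal, pot, h1, h2]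

theorem reveal_future (h : M.deadline n < j) (b del : Bool) (i : Fin K) :
    M.reveal n lam c (j - 1) b del i =
      if b then (if del then M.p n * M.β n else M.valPred n lam (j - M.deadline n) i)
      else if del then M.q n * M.β n else M.q n * c := by
  have h1 : j - 1 + 1 = j := by omega
  have h2 : ¬ j - 1 < M.deadline n := by omega
  cases b <;> cases del <;> simp [reveal, pot, h1, h2, h.ne']

theorem cont_true_false (i : Fin K) :
    M.cont n lam c j true false i = M.failVal n lam j i := by
  have hd := M.deadline_pos n
  rcases Nat.eq_zero_or_pos j with rfl | hj
  · rw [cont, failVal, if_pos rfl, if_pos hd]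
    exact (pmfMean_const _ 0).symm
  refine cont_eq_of_forall hj fun s => ?_
  rcases lt_trichotomy j (M.deadline n) with h | h | h
  · rw [reveal_past hj h]
    simp [h]
  · rw [h, reveal_current]
    simp [valPred]
  · rw [reveal_future h]
    simp [h.not_gt]

theorem cont_delivered (b : Bool) (i : Fin K) :
    M.cont n lam c j b true i =
      if j < M.deadline n then 0 else (if b then M.p n else M.q n) * M.β n := by
  have hd := M.deadline_pos n
  rcases Nat.eq_zero_or_pos j with rfl | hj
  · rw [cont, if_pos rfl, if_pos hd]
  refine Eq.trans (cont_eq_of_forall hj fun s => ?_) (pmfMean_const (M.P n i) _)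
  rcases lt_trichotomy j (M.deadline n) with h | h | h
  · rw [reveal_past hj h]
    simp [h]
  · rw [h, reveal_current]
    simp
  · rw [reveal_future h]
    cases b <;> simp [h.not_gt]

theorem cont_false_false (i : Fin K) :
    M.cont n lam c j false false i = if j < M.deadline n then 0 else if j = M.deadline n then
      M.q n * pmfMean (M.P n i) (M.val n lam (M.deadline n)) else M.q n * c := by
  have hd := M.deadline_pos n
  rcases Nat.eq_zero_or_pos j with rfl | hj
  · rw [cont, if_pos rfl, if_pos hd]
  rcases lt_trichotomy j (M.deadline n) with h | h | h
  · rw [if_pos h]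
    refine Eq.trans (cont_eq_of_forall hj fun s => ?_) (pmfMean_const (M.P n i) _)
    rw [reveal_past hj h]
    simp
  · rw [if_neg (by omega), if_pos h, ← pmfMean_const_mul]
    refine cont_eq_of_forall hj fun s => ?_
    rw [h, reveal_current]
    simp
  · rw [if_neg (by omega), if_neg (by omega)]
    refine Eq.trans (cont_eq_of_forall hj fun s => ?_) (pmfMean_const (M.P n i) _)
    rw [reveal_future h]
    simp

/-- A success in pre-service earns nothing at once; its worth `p * β` sits in the potential of the
delivered entry and is collected when the arrival is revealed. -/
theorem pending_mean (i : Fin K) (e : ℝ) :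
    M.ζ n i e * (M.slotGain n lam j true false e true + M.cont n lam c j true true i) +
      (1 - M.ζ n i e) * (M.slotGain n lam j true false e false + M.cont n lam c j true false i) =
    M.sendGain n lam (M.succVal n j) (M.failVal n lam j i) i e := by
  rw [cont_true_false, cont_delivered, sendGain, slotGain, slotGain, succVal]
  by_cases h : j < M.deadline n <;> simp [h] <;> ring

/-- The potential of an entry that cannot be sent is balanced exactly. The one exception is an
undelivered, negatively predicted entry about to become current: it has been credited `q * c`, while
its true mean value depends on the channel. There the choice of `c` as an upper or a lower bound
decides the direction of the inequality. -/
theorem idle_gain_eq {b del : Bool} (h : (b && !del) = false) (hdel : del = true ∨ j ≠ M.deadline n)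
    (i : Fin K) (e : ℝ) :
    M.slotGain n lam j b del e false + M.cont n lam c j b del i = M.pot n lam c j b del i := by
  rcases b with _ | _ <;> rcases del with _ | _
  · have hj : j ≠ M.deadline n := by simpa using hdel
    rw [cont_false_false, slotGain, pot]
    by_cases h1 : j < M.deadline n <;> simp [h1, hj]
  · rw [cont_delivered, slotGain, pot]
    by_cases h1 : j < M.deadline n <;> simp [h1]
  · simp at h
  · rw [cont_delivered, slotGain, pot]
    by_cases h1 : j < M.deadline n
    · simp [h1]
    · have h2 : j + 1 ≠ M.deadline n := by omega
      simp [h1, h2]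

theorem idle_gain_deadline (i : Fin K) (e : ℝ) :
    M.slotGain n lam (M.deadline n) false false e false +
      M.cont n lam c (M.deadline n) false false i =
      M.q n * pmfMean (M.P n i) (M.val n lam (M.deadline n)) := by
  rw [cont_false_false, slotGain]
  simp

theorem pot_deadline_false (i : Fin K) :
    M.pot n lam c (M.deadline n) false false i = M.q n * c := by
  simp [pot]

theorem idle_gain_le (hc : ∀ i, M.val n lam (M.deadline n) i ≤ c) {b del : Bool}
    (h : (b && !del) = false) (i : Fin K) (e : ℝ) :
    M.slotGain n lam j b del e false + M.cont n lam c j b del i ≤ M.pot n lam c j b del i := by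
  by_cases hdel : del = true ∨ j ≠ M.deadline n
  · exact (idle_gain_eq h hdel i e).le
  · push Not at hdel
    obtain ⟨h1, rfl⟩ := hdel
    obtain rfl : del = false := by simpa using h1
    obtain rfl : b = false := by simpa using h
    rw [idle_gain_deadline, pot_deadline_false]
    exact mul_le_mul_of_nonneg_left (pmfMean_le _ (.of_finite _) hc) (M.q_nonneg n)

theorem le_idle_gain (hc : ∀ i, c ≤ M.val n lam (M.deadline n) i) {b del : Bool}
    (h : (b && !del) = false) (i : Fin K) (e : ℝ) :
    M.pot n lam c j b del i ≤ M.slotGain n lam j b del e false + M.cont n lam c j b del i := by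
  by_cases hdel : del = true ∨ j ≠ M.deadline n
  · exact (idle_gain_eq h hdel i e).ge
  · push Not at hdel
    obtain ⟨h1, rfl⟩ := hdel
    obtain rfl : del = false := by simpa using h1
    obtain rfl : b = false := by simpa using h
    rw [idle_gain_deadline, pot_deadline_false]
    exact mul_le_mul_of_nonneg_left (le_pmfMean _ (.of_finite _) hc) (M.q_nonneg n)

/-- Mean potential of a fresh entry. -/
theorem reveal_fresh (D : ℕ) (b : Bool) (i : Fin K) :
    M.reveal n lam c (M.deadline n + D - 1) b false i =
      if b then M.valPred n lam D i
      else M.q n * (if D = 0 then M.val n lam (M.deadline n) i else c) := by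
  have hd := M.deadline_pos n
  rcases Nat.eq_zero_or_pos D with rfl | hD
  · rw [add_zero, reveal_current]
    cases b <;> simp [valPred]
  · rw [reveal_future (by omega), Nat.add_sub_cancel_left]
    cases b <;> simp [hD.ne']

end PredictiveSystem

theorem fin_sum_shift {L : ℕ} (hL : 0 < L) {G H : Fin L → ℝ} {F : ℝ} (h0 : H ⟨0, hL⟩ = 0)
    (hs : ∀ (j : Fin L) (h : j.1 + 1 < L), G j = H ⟨j.1 + 1, h⟩)
    (hl : ∀ j : Fin L, j.1 + 1 = L → G j = F) : ∑ j, G j = ∑ j, H j + F := by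
  obtain ⟨L, rfl⟩ : ∃ L', L = L' + 1 := ⟨L - 1, by omega⟩
  rw [Fin.sum_univ_castSucc G, Fin.sum_univ_succ H, hl _ (by simp)]
  have h0' : H 0 = 0 := h0
  rw [h0', zero_add]
  congr 1
  refine Finset.sum_congr rfl fun j _ => ?_
  rw [hs _ (by simp)]
  rfl

namespace PredictiveSystem

variable {N K : ℕ} (M : PredictiveSystem N K)

/-! ### The mean gain of a slot -/

instance (D : Fin N → ℕ) : Finite (M.State D) :=
  Finite.of_injective (fun x => (x.chan, x.present, x.delivered)) (by
    rintro ⟨a, b, c⟩ ⟨a', b', c'⟩ h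
    simp only [Prod.mk.injEq] at h
    obtain ⟨rfl, rfl, rfl⟩ := h
    rfl)

/-- A function of one bit is affine in its indicator, so the marginal arrival probability suffices,
whatever the dependence between packets of a slot. -/
theorem mean_truth (n : Fin N) (y : Fin M.Amax → Bool) (k : Fin M.Amax) (f : Bool → ℝ) :
    pmfMean (M.truth n y) (fun z => f (z k)) =
      (if y k then M.p n else M.q n) * f true + (1 - if y k then M.p n else M.q n) * f false := by
  have h : ∀ z : Fin M.Amax → Bool,
      f (z k) = f false + (f true - f false) * (if z k then 1 else 0) := by
    intro z
    cases z k <;> simp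
  simp only [h]
  rw [pmfMean_add _ (.of_finite _) (.of_finite _), pmfMean_const, pmfMean_const_mul,
    M.truth_marginal]
  ring

variable {M} {D : Fin N → ℕ}

theorem eq_current_iff (n : Fin N) (j : Fin (M.deadline n + D n)) :
    j = current M D n ↔ j.1 + 1 = M.deadline n := by
  have hd := M.deadline_pos n
  rw [Fin.ext_iff, current]
  simp only
  omega

theorem mean_outcomeLaw (x : M.State D) (a : M.Action D) (n : Fin N)
    (j : Fin (M.deadline n + D n)) (k : Fin M.Amax) (f : Bool → ℝ) :
    pmfMean (outcomeLaw x a) (fun w => f (w n j k)) =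
      if x.pending n j k then
        M.ζ n (x.chan n) (a n j k) * f true + (1 - M.ζ n (x.chan n) (a n j k)) * f false
      else f false := by
  rw [outcomeLaw]
  refine (pmfMean_indepLaw (γ := fun n => Fin (M.deadline n + D n) → Fin M.Amax → Bool) _ n
    (fun w => f (w j k))).trans ?_
  refine (pmfMean_indepLaw (γ := fun _ => Fin M.Amax → Bool) _ j (fun w => f (w k))).trans ?_
  refine (pmfMean_indepLaw (γ := fun _ => Bool) _ k f).trans ?_
  split_ifs
  · exact pmfMean_coinLaw _ _ f
  · exact pmfMean_pure _ f

/-- The table entry after the shift, given the fresh prediction pattern of the user. -/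
def shiftEntry (x : M.State D) (n : Fin N) (j : Fin (M.deadline n + D n)) (k : Fin M.Amax)
    (y : Fin M.Amax → Bool) : Bool :=
  if h : j.1 + 1 < M.deadline n + D n then x.present n ⟨j.1 + 1, h⟩ k else y k

theorem mean_nextLaw_pot (lam c : ℝ) (x : M.State D) (w : M.Outcome D) (n : Fin N)
    (j : Fin (M.deadline n + D n)) (k : Fin M.Amax) :
    pmfMean (nextLaw x w) (fun x' =>
        M.pot n lam c j (x'.present n j k) (x'.delivered n j k) (x'.chan n)) =
      pmfMean (M.P n (x.chan n)) fun s => pmfMean (M.pred n) fun y =>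
        M.reveal n lam c j (shiftEntry x n j k y) (shiftDelivered x w n j k) s := by
  rw [nextLaw, pmfMean_bind _ _ (.of_finite _)]
  refine Eq.trans ?_ (pmfMean_indepLaw (fun n => M.P n (x.chan n)) n _)
  congr 1
  funext s
  rw [pmfMean_bind _ _ (.of_finite _)]
  refine Eq.trans ?_ (pmfMean_indepLaw M.pred n _)
  congr 1
  funext y
  rw [pmfMean_map _ _ (.of_finite _)]
  change pmfMean _ (fun z : (n : Fin N) → Fin M.Amax → Bool => M.pot n lam c j
    (if j = current M D n then z n k else shiftEntry x n j k (y n))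
    (shiftDelivered x w n j k) (s n)) = _
  by_cases h : j = current M D n
  · simp only [if_pos h]
    refine (pmfMean_indepLaw (γ := fun _ => Fin M.Amax → Bool) _ n fun z =>
      M.pot n lam c j (z k) (shiftDelivered x w n j k) (s n)).trans ?_
    rw [mean_truth _ _ _ _ fun b => M.pot n lam c j b (shiftDelivered x w n j k) (s n),
      reveal, if_pos ((eq_current_iff n j).1 h), ← h]
    rfl
  · simp only [if_neg h]
    rw [pmfMean_const, reveal, if_neg (mt (eq_current_iff n j).2 h)]

/-- Mean potential of the fresh entry of the `k`-th packet of user `n`. -/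
def freshPot (lam c : ℝ) (x : M.State D) (n : Fin N) (k : Fin M.Amax) : ℝ :=
  pmfMean (M.P n (x.chan n)) fun s => pmfMean (M.pred n) fun y =>
    M.reveal n lam c (M.deadline n + D n - 1) (y k) false s

/-- Potential of a state. -/
def statePot (lam : ℝ) (c : Fin N → ℝ) (x : M.State D) : ℝ :=
  ∑ n, ∑ j : Fin (M.deadline n + D n), ∑ k,
    M.pot n lam (c n) j (x.present n j k) (x.delivered n j k) (x.chan n)

theorem mean_nextLaw_statePot (lam : ℝ) (c : Fin N → ℝ) (x : M.State D) (w : M.Outcome D) :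
    pmfMean (nextLaw x w) (statePot lam c) =
      ∑ n, (∑ j : Fin (M.deadline n + D n), ∑ k, M.cont n lam (c n) j (x.present n j k)
        (x.delivered n j k || w n j k) (x.chan n) + ∑ k, freshPot lam (c n) x n k) := by
  unfold statePot
  rw [pmfMean_sum _ _ fun _ _ => .of_finite _]
  refine Finset.sum_congr rfl fun n _ => ?_
  rw [pmfMean_sum _ _ fun _ _ => .of_finite _]
  have hd := M.deadline_pos n
  -- Position `j` of the next table holds today's entry `j + 1`; today's entry 0 expires with
  -- continuation 0, and the last position is filled by the fresh entry.
  refine fin_sum_shift (by omega) (by simp [cont]) (fun j h => ?_) fun j h => ?_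
  · rw [pmfMean_sum _ _ fun _ _ => .of_finite _]
    refine Finset.sum_congr rfl fun k _ => ?_
    rw [mean_nextLaw_pot]
    simp [shiftEntry, shiftDelivered, h, pmfMean_const, cont]
  · rw [pmfMean_sum _ _ fun _ _ => .of_finite _]
    refine Finset.sum_congr rfl fun k _ => ?_
    have hj : M.deadline n + D n - 1 = j.1 := by omega
    rw [mean_nextLaw_pot, freshPot, hj]
    simp [shiftEntry, shiftDelivered, h]

/-- Weighted deliveries minus priced consumption in a slot. -/
def netGain (lam : ℝ) (r : M.Step D) : ℝ :=
  ∑ n, M.β n * deliveries n r - lam * ∑ n, consumption n r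

theorem netGain_eq (lam : ℝ) (r : M.Step D) :
    netGain lam r = ∑ n, ∑ j : Fin (M.deadline n + D n), ∑ k,
      M.slotGain n lam j (r.1.present n j k) (r.1.delivered n j k) (r.2.1 n j k) (r.2.2 n j k) := by
  rw [netGain, Finset.mul_sum, ← Finset.sum_sub_distrib]
  refine Finset.sum_congr rfl fun n _ => ?_
  have hcur : (∑ k, if r.1.present n (current M D n) k ∧ r.1.delivered n (current M D n) k
      then (1 : ℝ) else 0) = ∑ j : Fin (M.deadline n + D n), ∑ k,
        if j.1 + 1 = M.deadline n ∧ r.1.present n j k ∧ r.1.delivered n j k then 1 else 0 := by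
    rw [Finset.sum_eq_single (current M D n)]
    · refine Finset.sum_congr rfl fun k _ => ?_
      simp [(eq_current_iff n _).1 rfl]
    · intro j _ hj
      simp [mt (eq_current_iff n j).2 hj]
    · simp
  rw [deliveries, consumption, hcur, ← Finset.sum_add_distrib, Finset.mul_sum, Finset.mul_sum,
    ← Finset.sum_sub_distrib]
  refine Finset.sum_congr rfl fun j _ => ?_
  rw [← Finset.sum_add_distrib, Finset.mul_sum, Finset.mul_sum, ← Finset.sum_sub_distrib]
  rfl

/-- Mean gain from a table entry in a slot, continuation included. -/
def entryMean (lam : ℝ) (c : Fin N → ℝ) (x : M.State D) (a : M.Action D) (n : Fin N)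
    (j : Fin (M.deadline n + D n)) (k : Fin M.Amax) : ℝ :=
  if x.pending n j k then
    M.sendGain n lam (M.succVal n j) (M.failVal n lam j (x.chan n)) (x.chan n) (a n j k)
  else M.slotGain n lam j (x.present n j k) (x.delivered n j k) (a n j k) false +
    M.cont n lam (c n) j (x.present n j k) (x.delivered n j k) (x.chan n)

/-- The drift identity behind both bounds: gain and potential are sums over table entries, so the
slot splits into separate one-packet problems plus the fresh entries. -/
theorem mean_slot (lam : ℝ) (c : Fin N → ℝ) (x : M.State D) (a : M.Action D) :
    pmfMean (outcomeLaw x a) (fun w =>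
        netGain lam (x, a, w) + pmfMean (nextLaw x w) (statePot lam c)) =
      ∑ n, (∑ j : Fin (M.deadline n + D n), ∑ k, entryMean lam c x a n j k +
        ∑ k, freshPot lam (c n) x n k) := by
  simp only [mean_nextLaw_statePot, netGain_eq, ← Finset.sum_add_distrib, ← add_assoc]
  rw [pmfMean_sum _ _ fun _ _ => .of_finite _]
  refine Finset.sum_congr rfl fun n _ => ?_
  rw [pmfMean_add _ (.of_finite _) (.of_finite _), pmfMean_const,
    pmfMean_sum _ _ fun _ _ => .of_finite _]
  congr 1
  refine Finset.sum_congr rfl fun j _ => ?_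
  rw [pmfMean_sum _ _ fun _ _ => .of_finite _]
  refine Finset.sum_congr rfl fun k _ => ?_
  rw [mean_outcomeLaw x a n j k fun o =>
    M.slotGain n lam j (x.present n j k) (x.delivered n j k) (a n j k) o +
    M.cont n lam (c n) j (x.present n j k) (x.delivered n j k || o) (x.chan n), entryMean]
  split_ifs with h
  · obtain ⟨h1, h2⟩ : x.present n j k = true ∧ x.delivered n j k = false := by
      simpa [State.pending] using h
    rw [h1, h2]
    exact pending_mean _ _
  · simp

theorem entryMean_le {lam : ℝ} (hlam : 0 ≤ lam) {c : Fin N → ℝ}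
    (hc : ∀ n i, M.val n lam (M.deadline n) i ≤ c n) (x : M.State D) (a : M.Action D) (n : Fin N)
    (j : Fin (M.deadline n + D n)) (k : Fin M.Amax) :
    entryMean lam c x a n j k ≤
      M.pot n lam (c n) j (x.present n j k) (x.delivered n j k) (x.chan n) := by
  rw [entryMean]
  split_ifs with h
  · obtain ⟨h1, h2⟩ : x.present n j k = true ∧ x.delivered n j k = false := by
      simpa [State.pending] using h
    rw [h1, h2, pot_pending]
    exact sendGain_le_bestGain hlam (failVal_le_succVal hlam _ _) _ (a n j k).2
  · exact idle_gain_le (hc n) (by simpa [State.pending] using h) _ _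

theorem le_entryMean {lam ε : ℝ} (hε : 0 ≤ ε) {c : Fin N → ℝ}
    (hc : ∀ n i, c n ≤ M.val n lam (M.deadline n) i) (x : M.State D) (a : M.Action D) (n : Fin N)
    (j : Fin (M.deadline n + D n)) (k : Fin M.Amax)
    (ha : M.bestGain n lam (M.succVal n j) (M.failVal n lam j (x.chan n)) (x.chan n) - ε ≤
      M.sendGain n lam (M.succVal n j) (M.failVal n lam j (x.chan n)) (x.chan n) (a n j k)) :
    M.pot n lam (c n) j (x.present n j k) (x.delivered n j k) (x.chan n) - ε ≤
      entryMean lam c x a n j k := by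
  rw [entryMean]
  split_ifs with h
  · obtain ⟨h1, h2⟩ : x.present n j k = true ∧ x.delivered n j k = false := by
      simpa [State.pending] using h
    rw [h1, h2, pot_pending]
    exact ha
  · exact (sub_le_self _ hε).trans (le_idle_gain (hc n) (by simpa [State.pending] using h) _ _)

/-- The sum is affine in the number of predicted packets, whose mean is `predictedRate`. -/
theorem sum_freshPot (lam c : ℝ) (x : M.State D) (n : Fin N) :
    ∑ k, freshPot lam c x n k = pmfMean (M.P n (x.chan n)) fun s =>
      M.predictedRate n * M.valPred n lam (D n) s + (M.Amax - M.predictedRate n) * M.q n *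
        if D n = 0 then M.val n lam (M.deadline n) s else c := by
  unfold freshPot
  rw [← pmfMean_sum _ _ fun _ _ => .of_finite _]
  congr 1
  funext s
  rw [← pmfMean_sum _ _ fun _ _ => .of_finite _, predictedRate_eq]
  simp only [reveal_fresh]
  set u := M.valPred n lam (D n) s
  set v := M.q n * if D n = 0 then M.val n lam (M.deadline n) s else c with hv
  have h : ∀ y : Fin M.Amax → Bool, (∑ k, if y k then u else v) = M.Amax * v + (u - v) * numTrue y := by
    intro y
    have h1 : (M.Amax : ℝ) * v = ∑ _k : Fin M.Amax, v := by simp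
    rw [h1, numTrue, Finset.mul_sum, ← Finset.sum_add_distrib]
    refine Finset.sum_congr rfl fun k _ => ?_
    cases y k <;> simp
  simp only [h]
  rw [pmfMean_add _ (.of_finite _) (.of_finite _), pmfMean_const, pmfMean_const_mul, mul_assoc, ← hv]
  ring

theorem predictedRate_nonneg (n : Fin N) : 0 ≤ M.predictedRate n := by
  rw [predictedRate_eq]
  exact le_pmfMean _ (.of_finite _) fun y => Finset.sum_nonneg fun k _ => by split_ifs <;> simp

theorem predictedRate_le (n : Fin N) : M.predictedRate n ≤ M.Amax := by
  rw [predictedRate_eq]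
  refine pmfMean_le _ (.of_finite _) fun y => (Finset.sum_le_card_nsmul _ _ 1 fun k _ => ?_).trans ?_
  · split_ifs <;> simp
  · simp

theorem sum_freshPot_le {lam c A : ℝ} (n : Fin N)
    (hc : ∀ i, M.val n lam (M.deadline n) i ≤ c) (hA : ∀ i, M.valPred n lam (D n) i ≤ A)
    (x : M.State D) : ∑ k, freshPot lam c x n k ≤
      M.predictedRate n * A + (M.Amax - M.predictedRate n) * M.q n * c := by
  rw [sum_freshPot]
  refine pmfMean_le _ (.of_finite _) fun s => add_le_add
    (mul_le_mul_of_nonneg_left (hA s) (predictedRate_nonneg n)) (mul_le_mul_of_nonneg_left ?_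
      (mul_nonneg (sub_nonneg.2 (predictedRate_le n)) (M.q_nonneg n)))
  split_ifs
  exacts [hc s, le_rfl]

theorem le_sum_freshPot {lam c A : ℝ} (n : Fin N)
    (hc : ∀ i, c ≤ M.val n lam (M.deadline n) i) (hA : ∀ i, A ≤ M.valPred n lam (D n) i)
    (x : M.State D) : M.predictedRate n * A + (M.Amax - M.predictedRate n) * M.q n * c ≤
      ∑ k, freshPot lam c x n k := by
  rw [sum_freshPot]
  refine le_pmfMean _ (.of_finite _) fun s => add_le_add
    (mul_le_mul_of_nonneg_left (hA s) (predictedRate_nonneg n)) (mul_le_mul_of_nonneg_left ?_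
      (mul_nonneg (sub_nonneg.2 (predictedRate_le n)) (M.q_nonneg n)))
  split_ifs
  exacts [hc s, le_rfl]

end PredictiveSystem

/-! ### Time averages under a bounded drift -/

theorem cesaro_limit_le {a w : ℕ → ℝ} {C B L : ℝ} (h : ∀ t, a t + w (t + 1) ≤ w t + C)
    (hw : ∀ t, |w t| ≤ B)
    (ha : Tendsto (fun T : ℕ => (1 / (T : ℝ)) * ∑ t ∈ Finset.Icc 1 T, a t) atTop (𝓝 L)) :
    L ≤ C := by
  have hsum : ∀ T : ℕ, ∑ t ∈ Finset.Icc 1 T, a t ≤ w 1 - w (T + 1) + T * C := by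
    intro T
    induction T with
    | zero => simp
    | succ T ih =>
      rw [Finset.sum_Icc_succ_top (by omega)]
      push_cast
      linarith [h (T + 1)]
  have hlim : Tendsto (fun T : ℕ => (2 * B) * (1 / (T : ℝ)) + C) atTop (𝓝 ((2 * B) * 0 + C)) :=
    (tendsto_one_div_atTop_nhds_zero_nat.const_mul _).add_const _
  rw [mul_zero, zero_add] at hlim
  refine le_of_tendsto_of_tendsto ha hlim ?_
  filter_upwards [eventually_gt_atTop 0] with T hT
  have hT' : (0 : ℝ) < T := by exact_mod_cast hT
  have h1 := (abs_le.1 (hw 1)).2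
  have h2 := (abs_le.1 (hw (T + 1))).1
  have h3 : ∑ t ∈ Finset.Icc 1 T, a t ≤ 2 * B + T * C := by linarith [hsum T]
  calc (1 / (T : ℝ)) * ∑ t ∈ Finset.Icc 1 T, a t ≤ (1 / (T : ℝ)) * (2 * B + T * C) :=
        mul_le_mul_of_nonneg_left h3 (by positivity)
    _ = (2 * B) * (1 / (T : ℝ)) + C := by field_simp

theorem le_cesaro_limit {a w : ℕ → ℝ} {C B L : ℝ} (h : ∀ t, w t + C ≤ a t + w (t + 1))
    (hw : ∀ t, |w t| ≤ B)
    (ha : Tendsto (fun T : ℕ => (1 / (T : ℝ)) * ∑ t ∈ Finset.Icc 1 T, a t) atTop (𝓝 L)) :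
    C ≤ L := by
  have := cesaro_limit_le (a := fun t => -a t) (w := fun t => -w t) (C := -C) (L := -L) (B := B)
    (fun t => by linarith [h t]) (fun t => by simpa using hw t)
    (by simpa [Finset.sum_neg_distrib] using ha.neg)
  linarith

namespace PredictiveSystem

variable {N K : ℕ} {M : PredictiveSystem N K} {D : Fin N → ℕ}

/-! ### Dynamics of the means -/

theorem isBdd_ite_one_zero {α : Type} (p : α → Prop) [DecidablePred p] :
    IsBdd fun a => if p a then (1 : ℝ) else 0 :=
  ⟨1, fun a => by dsimp only; split_ifs <;> simp⟩

theorem isBdd_deliveries (n : Fin N) : IsBdd (deliveries (M := M) (D := D) n) :=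
  (IsBdd.sum fun _ _ => IsBdd.sum fun _ _ => isBdd_ite_one_zero _).add
    (IsBdd.sum fun _ _ => isBdd_ite_one_zero _)

theorem isBdd_consumption (n : Fin N) : IsBdd (consumption (M := M) (D := D) n) := by
  refine IsBdd.sum fun j _ => IsBdd.sum fun k _ => ?_
  obtain ⟨C, hC⟩ := M.levels_bdd
  refine ⟨|C|, fun r => ?_⟩
  dsimp only
  split_ifs
  · rw [abs_of_nonneg (M.levels_nonneg _ (r.2.1 n j k).2)]
    exact (hC (r.2.1 n j k).2).trans (le_abs_self C)
  · simp

theorem isBdd_totalConsumption : IsBdd fun r : M.Step D => ∑ n, consumption n r :=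
  IsBdd.sum fun n _ => isBdd_consumption n

theorem netGain_eq_add (lam : ℝ) : netGain (M := M) (D := D) lam =
    fun r => (∑ n, M.β n * deliveries n r) + -lam * ∑ n, consumption n r := by
  funext r
  rw [netGain]
  ring

theorem isBdd_netGain (lam : ℝ) : IsBdd (netGain (M := M) (D := D) lam) := by
  rw [netGain_eq_add]
  exact (IsBdd.sum fun n _ => (isBdd_deliveries n).const_mul _).add
    (isBdd_totalConsumption.const_mul _)

theorem pmfMean_netGain (μ : PMF (M.Step D)) (lam : ℝ) :
    pmfMean μ (netGain lam) = ∑ n, M.β n * pmfMean μ (deliveries n) -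
      lam * pmfMean μ fun r => ∑ n, consumption n r := by
  rw [netGain_eq_add, pmfMean_add _ (IsBdd.sum fun n _ => (isBdd_deliveries n).const_mul _)
    (isBdd_totalConsumption.const_mul _), pmfMean_const_mul,
    pmfMean_sum _ _ fun n _ => (isBdd_deliveries n).const_mul _]
  simp only [pmfMean_const_mul]
  ring

variable {init : PMF (M.State D)} {π : M.Policy D}

theorem Achieves.tendsto_netGain {x : Fin N → ℝ} {Eav : ℝ} (h : Achieves init π x Eav) (lam : ℝ) :
    Tendsto (fun T : ℕ => (1 / (T : ℝ)) * ∑ t ∈ Finset.Icc 1 T,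
      pmfMean (slotLaw init π t) (netGain lam)) atTop (𝓝 (∑ n, M.β n * x n - lam * Eav)) := by
  have h1 := (tendsto_finsetSum Finset.univ fun n _ => (h.throughput n).const_mul (M.β n)).sub
    (h.expenditure.const_mul lam)
  refine h1.congr fun T => ?_
  simp only [pmfMean_netGain, Finset.sum_sub_distrib, ← Finset.mul_sum, mul_sub]
  rw [Finset.sum_comm]
  simp only [← Finset.mul_sum]
  congr 1
  · rw [Finset.mul_sum]
    exact Finset.sum_congr rfl fun n _ => by ring
  · ring

theorem mean_slotLaw (t : ℕ) {f : M.Step D → ℝ} (hf : IsBdd f) :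
    pmfMean (slotLaw init π t) f = pmfMean (historyLaw init π t) fun hx =>
      pmfMean (π hx.1 hx.2) fun a => pmfMean (outcomeLaw hx.2 a) fun w => f (hx.2, a, w) := by
  have hf' : IsBdd fun r : List (M.Step D) × M.Step D => f r.2 := hf.comp _
  rw [slotLaw, pmfMean_map _ _ hf, pmfMean_bind _ _ hf']
  congr 1
  funext hx
  rw [playSlot, pmfMean_bind _ _ hf']
  congr 1
  funext a
  rw [pmfMean_map _ _ hf']

theorem mean_historyLaw_succ (t : ℕ) (f : M.State D → ℝ) :
    pmfMean (historyLaw init π (t + 1)) (fun hx => f hx.2) =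
      pmfMean (slotLaw init π t) fun r => pmfMean (nextLaw r.1 r.2.2) f := by
  obtain ⟨C, hC⟩ := IsBdd.of_finite f
  have hf' : IsBdd fun hx : List (M.Step D) × M.State D => f hx.2 := ⟨C, fun _ => hC _⟩
  rw [historyLaw, pmfMean_bind _ _ hf', slotLaw,
    pmfMean_map _ _ ⟨C, fun r => abs_pmfMean_le _ hC⟩]
  congr 1
  funext r
  rw [pmfMean_map _ _ hf']

theorem isBdd_mean_nextLaw (f : M.State D → ℝ) :
    IsBdd fun r : M.Step D => pmfMean (nextLaw r.1 r.2.2) f := by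
  obtain ⟨C, hC⟩ := IsBdd.of_finite f
  exact ⟨C, fun r => abs_pmfMean_le _ hC⟩

/-- Mean net gain in a slot plus mean potential after it, given the history. -/
theorem mean_slot_add (t : ℕ) (lam : ℝ) (f : M.State D → ℝ) :
    pmfMean (slotLaw init π t) (netGain lam) +
        pmfMean (historyLaw init π (t + 1)) (fun hx => f hx.2) =
      pmfMean (historyLaw init π t) fun hx => pmfMean (π hx.1 hx.2) fun a =>
        pmfMean (outcomeLaw hx.2 a) fun w =>
          netGain lam (hx.2, a, w) + pmfMean (nextLaw hx.2 w) f := by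
  rw [mean_historyLaw_succ, ← pmfMean_add _ (isBdd_netGain lam) (isBdd_mean_nextLaw f),
    mean_slotLaw _ ((isBdd_netGain lam).add (isBdd_mean_nextLaw f))]

theorem exists_bound_mean_slot (lam : ℝ) (f : M.State D → ℝ) : ∃ C, ∀ (x : M.State D) a,
    |pmfMean (outcomeLaw x a) fun w => netGain lam (x, a, w) + pmfMean (nextLaw x w) f| ≤ C := by
  obtain ⟨C, hC⟩ := (isBdd_netGain (M := M) (D := D) lam).add (isBdd_mean_nextLaw f)
  exact ⟨C, fun x a => abs_pmfMean_le _ fun w => hC (x, a, w)⟩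

theorem Achieves.le_of_potential {x : Fin N → ℝ} {Eav lam C : ℝ} (h : Achieves init π x Eav)
    (f : M.State D → ℝ) (hf : ∀ x a, (pmfMean (outcomeLaw x a) fun w =>
      netGain lam (x, a, w) + pmfMean (nextLaw x w) f) ≤ f x + C) :
    ∑ n, M.β n * x n - lam * Eav ≤ C := by
  obtain ⟨B, hB⟩ := IsBdd.of_finite f
  obtain ⟨B', hB'⟩ := exists_bound_mean_slot lam f
  refine cesaro_limit_le (w := fun t => pmfMean (historyLaw init π t) fun hx => f hx.2) (B := B)
    (fun t => ?_) (fun t => abs_pmfMean_le _ fun hx => hB hx.2) (h.tendsto_netGain lam)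
  have hf1 : IsBdd fun hx : List (M.Step D) × M.State D => f hx.2 := ⟨B, fun _ => hB _⟩
  rw [mean_slot_add, ← pmfMean_const (historyLaw init π t) C, ← pmfMean_add _ hf1 ⟨|C|, fun _ => le_rfl⟩]
  exact pmfMean_mono _ ⟨B', fun hx => abs_pmfMean_le _ fun a => hB' _ _⟩
    (hf1.add ⟨|C|, fun _ => le_rfl⟩)
    fun hx => pmfMean_le _ ⟨B', fun a => hB' _ _⟩ fun a => hf _ _

theorem Achieves.ge_of_potential {x : Fin N → ℝ} {Eav lam C : ℝ} {σ : M.State D → M.Action D}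
    (h : Achieves init (fun _ x => PMF.pure (σ x)) x Eav)
    (f : M.State D → ℝ) (hf : ∀ x, f x + C ≤ pmfMean (outcomeLaw x (σ x)) fun w =>
      netGain lam (x, σ x, w) + pmfMean (nextLaw x w) f) :
    C ≤ ∑ n, M.β n * x n - lam * Eav := by
  obtain ⟨B, hB⟩ := IsBdd.of_finite f
  obtain ⟨B', hB'⟩ := exists_bound_mean_slot lam f
  refine le_cesaro_limit
    (w := fun t => pmfMean (historyLaw init (fun _ x => PMF.pure (σ x)) t) fun hx => f hx.2)
    (B := B) (fun t => ?_) (fun t => abs_pmfMean_le _ fun hx => hB hx.2) (h.tendsto_netGain lam)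
  have hf1 : IsBdd fun hx : List (M.Step D) × M.State D => f hx.2 := ⟨B, fun _ => hB _⟩
  rw [mean_slot_add, ← pmfMean_const (historyLaw init (fun _ x => PMF.pure (σ x)) t) C,
    ← pmfMean_add _ hf1 ⟨|C|, fun _ => le_rfl⟩]
  refine pmfMean_mono _ (hf1.add ⟨|C|, fun _ => le_rfl⟩)
    ⟨B', fun hx => abs_pmfMean_le _ fun a => hB' _ _⟩ fun hx => ?_
  rw [pmfMean_pure]
  exact hf hx.2

/-! ### The upper bound -/

variable (M D)

/-- Upper dual function for window lengths `D`. -/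
def gu (lam : ℝ) : ℝ :=
  lam * M.budget + ∑ n,
    (M.predictedRate n * min (M.p n * M.β n) (M.VuPred n lam (M.deadline n + D n)) +
      (M.Amax - M.predictedRate n) * M.q n * min (M.β n) (M.Vu n lam (M.deadline n)))

/-- Lower dual function for window lengths `D`. -/
def gl (lam : ℝ) : ℝ :=
  lam * M.budget + ∑ n,
    (M.predictedRate n * max 0 (max (M.VlPred n lam (M.deadline n))
        (M.VlPred n lam (M.deadline n + D n))) +
      (M.Amax - M.predictedRate n) * M.q n * max 0 (M.Vl n lam (M.deadline n)))

variable {M D}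

theorem Achieves.le_gu {x : Fin N → ℝ} {Eav lam : ℝ} (h : Achieves init π x Eav) (hlam : 0 ≤ lam)
    (hE : Eav ≤ M.budget) : ∑ n, M.β n * x n ≤ M.gu D lam := by
  -- Crediting unpredicted packets with an upper bound of their value makes the drift inequality
  -- hold for every action.
  set c : Fin N → ℝ := fun n => min (M.β n) (M.Vu n lam (M.deadline n))
  have hc : ∀ n i, M.val n lam (M.deadline n) i ≤ c n := fun n => M.val_le_min n hlam _
  have h1 := h.le_of_potential (statePot lam c) (lam := lam) (C := _) fun x a => by
    rw [mean_slot, Finset.sum_add_distrib]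
    exact add_le_add (Finset.sum_le_sum fun n _ => Finset.sum_le_sum fun j _ =>
      Finset.sum_le_sum fun k _ => entryMean_le hlam hc x a n j k) (Finset.sum_le_sum fun n _ =>
        sum_freshPot_le n (hc n) (M.valPred_le_min n hlam (D n)) x)
  have h2 := mul_le_mul_of_nonneg_left hE hlam
  rw [gu]
  linarith

theorem exists_stationary_ge_gl {lam : ℝ} (hlam : 0 ≤ lam) {δ : ℝ} (hδ : 0 < δ) :
    ∃ σ : M.State D → M.Action D, ∀ (x : Fin N → ℝ) (Eav : ℝ),
      Achieves init (fun _ x => PMF.pure (σ x)) x Eav →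
      M.gl D lam - lam * M.budget - δ ≤ ∑ n, M.β n * x n - lam * Eav := by
  set S : ℝ := ∑ n, ∑ _j : Fin (M.deadline n + D n), ∑ _k : Fin M.Amax, (1 : ℝ) with hS
  have hS0 : 0 ≤ S := Finset.sum_nonneg fun _ _ => Finset.sum_nonneg fun _ _ =>
    Finset.sum_nonneg fun _ _ => zero_le_one
  -- `S` counts the table entries, so an error `ε` per entry costs at most `δ` per slot; the `+ 1`
  -- avoids division by zero.
  set ε : ℝ := δ / (S + 1) with hε
  have hε0 : 0 < ε := by positivity
  have hεS : S * ε ≤ δ := by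
    rw [hε, mul_div_assoc', div_le_iff₀ (by positivity)]
    nlinarith
  -- The supremum over levels need not be attained, hence an `ε`-optimal level for each position and
  -- channel state.
  choose e he using fun (n : Fin N) (j : ℕ) (i : Fin K) =>
    M.exists_level_maxLevel_sub_le (M.sendGain n lam (M.succVal n j) (M.failVal n lam j i) i) hε0
  set c : Fin N → ℝ := fun n => max 0 (M.Vl n lam (M.deadline n))
  have hc : ∀ n i, c n ≤ M.val n lam (M.deadline n) i := fun n => M.max_Vl_le_val n hlam _
  refine ⟨fun x n j _ => e n j (x.chan n), fun x Eav h => ?_⟩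
  refine le_trans ?_ (h.ge_of_potential (statePot lam c) (lam := lam)
    (C := -(S * ε) + (M.gl D lam - lam * M.budget)) fun x => ?_)
  · linarith
  rw [mean_slot, Finset.sum_add_distrib, ← add_assoc, gl, add_sub_cancel_left]
  refine add_le_add ?_ (Finset.sum_le_sum fun n _ =>
    le_sum_freshPot n (hc n) (M.max_VlPred_le_valPred n hlam (D n)) x)
  rw [← sub_eq_add_neg, statePot, hS]
  simp only [Finset.sum_mul, ← Finset.sum_sub_distrib, one_mul]
  exact Finset.sum_le_sum fun n _ => Finset.sum_le_sum fun j _ => Finset.sum_le_sum fun k _ =>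
    le_entryMean hε0.le hc x _ n j k (he n j (x.chan n))

end PredictiveSystem

/-- Cesàro averages of the powers of a nonexpansive operator on a finite-dimensional space
converge. -/
theorem exists_tendsto_cesaro_pow {V : Type*} [NormedAddCommGroup V] [NormedSpace ℝ V]
    [FiniteDimensional ℝ V] (T : Module.End ℝ V) (hT : ∀ v, ‖T v‖ ≤ ‖v‖) (v : V) :
    ∃ g, Tendsto (fun n : ℕ => (1 / (n : ℝ)) • ∑ t ∈ Finset.Icc 1 n, (T ^ t) v) atTop (𝓝 g) := by
  have hpow : ∀ (t : ℕ) (v : V), ‖(T ^ t) v‖ ≤ ‖v‖ := by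
    intro t v
    induction t with
    | zero => simp
    | succ t ih => rw [pow_succ', Module.End.mul_apply]; exact (hT _).trans ih
  have hfix : ∀ u, T u = u → ∀ t : ℕ, (T ^ t) u = u := by
    intro u hu t
    induction t with
    | zero => simp
    | succ t ih => rw [pow_succ, Module.End.mul_apply, hu, ih]
  have htel : ∀ u w, T u = u → ∀ n : ℕ, ∑ t ∈ Finset.Icc 1 n, (T ^ t) (u + (T w - w)) =
      (n : ℝ) • u + ((T ^ (n + 1)) w - T w) := by
    intro u w hu n
    induction n with
    | zero => simp
    | succ n ih =>
      rw [Finset.sum_Icc_succ_top (by omega), ih, map_add, map_sub, hfix u hu,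
        ← Module.End.mul_apply, ← pow_succ]
      push_cast
      module
  have hlim : ∀ u w, T u = u → Tendsto (fun n : ℕ =>
      (1 / (n : ℝ)) • ∑ t ∈ Finset.Icc 1 n, (T ^ t) (u + (T w - w))) atTop (𝓝 u) := by
    intro u w hu
    have h0 : Tendsto (fun n : ℕ => (1 / (n : ℝ)) • ((T ^ (n + 1)) w - T w)) atTop (𝓝 0) := by
      refine squeeze_zero_norm (a := fun n : ℕ => (1 / (n : ℝ)) * (‖w‖ + ‖w‖)) (fun n => ?_) ?_
      · rw [norm_smul, Real.norm_of_nonneg (by positivity)]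
        exact mul_le_mul_of_nonneg_left ((norm_sub_le _ _).trans (add_le_add (hpow _ _) (hT w)))
          (by positivity)
      · simpa using tendsto_one_div_atTop_nhds_zero_nat.mul_const (‖w‖ + ‖w‖)
    have h1 := h0.const_add u
    rw [add_zero] at h1
    refine h1.congr' ?_
    filter_upwards [eventually_gt_atTop 0] with n hn
    have hn' : (n : ℝ) ≠ 0 := by exact_mod_cast hn.ne'
    rw [htel u w hu, smul_add, smul_smul, one_div_mul_cancel hn', one_smul]
  -- A vector in both has Cesàro limit itself (it is fixed) and 0 (it is a coboundary). By
  -- rank-nullity the two subspaces then span everything.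
  have hdisj : Disjoint (LinearMap.ker (T - 1)) (LinearMap.range (T - 1)) := by
    rw [Submodule.disjoint_def]
    rintro u hu ⟨w, rfl⟩
    set u := (T - 1) w with hu'
    have hu1 : T u = u := by simpa [sub_eq_zero] using hu
    have h1 := hlim 0 w (by simp)
    have h2 := hlim u 0 hu1
    rw [show T 0 - 0 = (0 : V) by simp, add_zero] at h2
    rw [zero_add, show T w - w = u by simp [hu']] at h1
    exact tendsto_nhds_unique h2 h1
  have htop : LinearMap.ker (T - 1) ⊔ LinearMap.range (T - 1) = ⊤ := by
    refine Submodule.eq_top_of_disjoint _ _ ?_ hdisj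
    rw [add_comm, LinearMap.finrank_range_add_finrank_ker]
  obtain ⟨u, hu, _, ⟨w, rfl⟩, rfl⟩ := Submodule.mem_sup.1 (htop ▸ Submodule.mem_top : v ∈ _)
  exact ⟨u, by simpa using hlim u w (by simpa [sub_eq_zero] using hu)⟩

namespace PredictiveSystem

variable {N K : ℕ} {M : PredictiveSystem N K} {D : Fin N → ℕ} {init : PMF (M.State D)}

/-! ### Stationary policies -/

/-- Transition operator of the states under a stationary deterministic policy. -/
def stationaryOp (σ : M.State D → M.Action D) : Module.End ℝ (M.State D → ℝ) where
  toFun f x := pmfMean (outcomeLaw x (σ x)) fun w => pmfMean (nextLaw x w) f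
  map_add' f g := by
    funext x
    rw [Pi.add_apply, ← pmfMean_add _ (.of_finite _) (.of_finite _)]
    congr 1
    funext w
    exact pmfMean_add _ (.of_finite _) (.of_finite _)
  map_smul' r f := by
    funext x
    rw [Pi.smul_apply, RingHom.id_apply, smul_eq_mul, ← pmfMean_const_mul]
    congr 1
    funext w
    exact pmfMean_const_mul _ _ _

theorem mean_historyLaw_stationary (σ : M.State D → M.Action D) (t : ℕ) (f : M.State D → ℝ) :
    pmfMean (historyLaw init (fun _ x => PMF.pure (σ x)) t) (fun hx => f hx.2) =
      pmfMean init ((stationaryOp σ ^ t) f) := by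
  induction t generalizing f with
  | zero =>
    obtain ⟨C, hC⟩ := IsBdd.of_finite f
    rw [historyLaw, pmfMean_map _ _ ⟨C, fun _ => hC _⟩]
    rfl
  | succ t ih =>
    rw [mean_historyLaw_succ, mean_slotLaw _ (isBdd_mean_nextLaw f), pow_succ,
      Module.End.mul_apply, ← ih]
    simp only [pmfMean_pure]
    rfl

theorem exists_tendsto_stationary (σ : M.State D → M.Action D) {F : M.Step D → ℝ}
    (hF : IsBdd F) : ∃ L, Tendsto (fun T : ℕ => (1 / (T : ℝ)) * ∑ t ∈ Finset.Icc 1 T,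
      pmfMean (slotLaw init (fun _ x => PMF.pure (σ x)) t) F) atTop (𝓝 L) := by
  have : Fintype (M.State D) := Fintype.ofFinite _
  set f : M.State D → ℝ := fun x => pmfMean (outcomeLaw x (σ x)) fun w => F (x, σ x, w)
  obtain ⟨g, hg⟩ := exists_tendsto_cesaro_pow (stationaryOp σ) (fun f => by
    refine (pi_norm_le_iff_of_nonneg (norm_nonneg f)).2 fun x => ?_
    exact abs_pmfMean_le _ fun w => abs_pmfMean_le _ fun x' => norm_le_pi_norm f x') f
  have hcont : Continuous fun f : M.State D → ℝ => pmfMean init f := by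
    simp only [pmfMean, tsum_fintype]
    fun_prop
  refine ⟨pmfMean init g, ((hcont.tendsto g).comp hg).congr fun T => ?_⟩
  have h1 : ∀ t, pmfMean (slotLaw init (fun _ x => PMF.pure (σ x)) t) F =
      pmfMean init ((stationaryOp σ ^ t) f) := by
    intro t
    rw [mean_slotLaw _ hF, ← mean_historyLaw_stationary]
    simp only [pmfMean_pure]
    rfl
  simp only [h1]
  rw [← pmfMean_sum _ _ fun _ _ => .of_finite _, ← pmfMean_const_mul]
  refine congrArg (pmfMean init) (funext fun x => ?_)
  simp

theorem exists_achieves_stationary (σ : M.State D → M.Action D) :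
    ∃ x Eav, Achieves init (fun _ x => PMF.pure (σ x)) x Eav := by
  choose x hx using fun n => exists_tendsto_stationary (init := init) σ (isBdd_deliveries n)
  obtain ⟨Eav, hE⟩ := exists_tendsto_stationary (init := init) σ isBdd_totalConsumption
  exact ⟨x, Eav, hx, hE⟩

/-- Never transmitting is feasible and, as the budget is positive, strictly so: it serves as the
Slater point. -/
theorem exists_achieves_zero : ∃ (π : M.Policy D) (x : Fin N → ℝ), Achieves init π x 0 := by
  obtain ⟨x, Eav, h⟩ := exists_achieves_stationary (init := init) (M := M) (D := D)
    fun _ _ _ _ => ⟨0, M.zero_mem⟩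
  refine ⟨_, x, h.throughput, ?_⟩
  refine tendsto_const_nhds.congr fun T => ?_
  rw [Finset.sum_eq_zero, mul_zero]
  intro t _
  rw [mean_slotLaw _ isBdd_totalConsumption]
  simp [pmfMean_pure, consumption, pmfMean_const]

end PredictiveSystem

/-! ### Mixtures of laws -/

/-- `μ` is the mixture of `μ₁` and `μ₂` with weights `a` and `b`. -/
def IsMixture {α : Type} (a b : ℝ≥0∞) (μ μ₁ μ₂ : PMF α) : Prop := ∀ s, μ s = a * μ₁ s + b * μ₂ s

namespace IsMixture

variable {α β : Type} {a b : ℝ≥0∞} {μ μ₁ μ₂ : PMF α}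

/-- If the joint laws of two successive choices are mixtures, so is the marginal of the second. -/
theorem bind_of_joint {κ κ₁ κ₂ : α → PMF β}
    (h : ∀ s t, μ s * κ s t = a * (μ₁ s * κ₁ s t) + b * (μ₂ s * κ₂ s t)) :
    IsMixture a b (μ.bind κ) (μ₁.bind κ₁) (μ₂.bind κ₂) := fun t => by
  simp only [PMF.bind_apply, h, ENNReal.tsum_add, ENNReal.tsum_mul_left]

theorem bind (h : IsMixture a b μ μ₁ μ₂) (κ : α → PMF β) :
    IsMixture a b (μ.bind κ) (μ₁.bind κ) (μ₂.bind κ) :=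
  bind_of_joint fun s t => by rw [h s]; ring

theorem map (h : IsMixture a b μ μ₁ μ₂) (g : α → β) :
    IsMixture a b (μ.map g) (μ₁.map g) (μ₂.map g) := h.bind _

theorem self (hab : a + b = 1) (μ : PMF α) : IsMixture a b μ μ μ := fun s => by
  rw [← add_mul, hab, one_mul]

theorem mean (h : IsMixture a b μ μ₁ μ₂) (hab : a + b = 1) {f : α → ℝ} (hf : IsBdd f) :
    pmfMean μ f = a.toReal * pmfMean μ₁ f + b.toReal * pmfMean μ₂ f := by
  have ha : a ≠ ⊤ := ne_top_of_le_ne_top ENNReal.one_ne_top (hab ▸ le_self_add)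
  have hb : b ≠ ⊤ := ne_top_of_le_ne_top ENNReal.one_ne_top (hab ▸ le_add_self)
  simp only [pmfMean]
  rw [← tsum_mul_left, ← tsum_mul_left, ← ((summable_mass_mul μ₁ hf).mul_left _).tsum_add
    ((summable_mass_mul μ₂ hf).mul_left _)]
  refine tsum_congr fun s => ?_
  rw [h s, ENNReal.toReal_add (ENNReal.mul_ne_top ha (μ₁.apply_ne_top s))
    (ENNReal.mul_ne_top hb (μ₂.apply_ne_top s)), ENNReal.toReal_mul, ENNReal.toReal_mul]
  ring

end IsMixture

/-- Normalization of a weighted sum of two laws. -/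
theorem exists_normalized_mixture {α : Type} (w₁ w₂ : ℝ≥0∞) (h₁ : w₁ ≠ ⊤) (h₂ : w₂ ≠ ⊤)
    (μ₁ μ₂ : PMF α) : ∃ μ : PMF α, ∀ s, (w₁ + w₂) * μ s = w₁ * μ₁ s + w₂ * μ₂ s := by
  by_cases h0 : w₁ + w₂ = 0
  · obtain ⟨rfl, rfl⟩ := add_eq_zero.1 h0
    exact ⟨μ₁, by simp⟩
  have hsum : ∑' s, (w₁ * μ₁ s + w₂ * μ₂ s) = w₁ + w₂ := by
    rw [ENNReal.tsum_add, ENNReal.tsum_mul_left, ENNReal.tsum_mul_left, μ₁.tsum_coe, μ₂.tsum_coe,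
      mul_one, mul_one]
  have htop : w₁ + w₂ ≠ ⊤ := ENNReal.add_ne_top.2 ⟨h₁, h₂⟩
  refine ⟨PMF.normalize (fun s => w₁ * μ₁ s + w₂ * μ₂ s) (hsum ▸ h0) (hsum ▸ htop), fun s => ?_⟩
  rw [PMF.normalize_apply, hsum, mul_comm, mul_assoc, ENNReal.inv_mul_cancel h0 htop, mul_one]

/-! ### Randomization between policies and convexity of the achievable set -/

namespace PredictiveSystem

variable {N K : ℕ} {M : PredictiveSystem N K} {D : Fin N → ℕ} {init : PMF (M.State D)}

theorem length_of_historyLaw_ne_zero {π : M.Policy D} {t : ℕ}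
    {hx : List (M.Step D) × M.State D} (h : historyLaw init π t hx ≠ 0) : hx.1.length = t := by
  induction t generalizing hx with
  | zero =>
    rw [← PMF.mem_support_iff, historyLaw, PMF.mem_support_map_iff] at h
    obtain ⟨x, -, rfl⟩ := h
    rfl
  | succ t ih =>
    rw [← PMF.mem_support_iff, historyLaw, PMF.mem_support_bind_iff] at h
    obtain ⟨r, hr, h⟩ := h
    rw [PMF.mem_support_map_iff] at h
    obtain ⟨x, -, rfl⟩ := h
    rw [PMF.mem_support_bind_iff] at hr
    obtain ⟨hy, hhy, hr⟩ := hr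
    rw [playSlot, PMF.mem_support_bind_iff] at hr
    obtain ⟨a, -, hr⟩ := hr
    rw [PMF.mem_support_map_iff] at hr
    obtain ⟨w, -, rfl⟩ := hr
    simp [ih ((PMF.mem_support_iff _ _).1 hhy)]

/-- A random choice between two policies at the start can be simulated by a single policy. -/
theorem exists_mixed_policy (a b : ℝ≥0∞) (hab : a + b = 1) (init : PMF (M.State D))
    (π₁ π₂ : M.Policy D) : ∃ π : M.Policy D, ∀ t,
      IsMixture a b (slotLaw init π t) (slotLaw init π₁ t) (slotLaw init π₂ t) := by
  have ha : a ≠ ⊤ := ne_top_of_le_ne_top ENNReal.one_ne_top (hab ▸ le_self_add)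
  have hb : b ≠ ⊤ := ne_top_of_le_ne_top ENNReal.one_ne_top (hab ▸ le_add_self)
  -- The mixed policy uses posterior weights: given the history, each policy counts in proportion to
  -- its prior weight times the probability of that history under it. The slot number is recovered
  -- as the length of the history.
  choose π hπ using fun (h : List (M.Step D)) (x : M.State D) => exists_normalized_mixture
    (a * historyLaw init π₁ h.length (h, x)) (b * historyLaw init π₂ h.length (h, x))
    (ENNReal.mul_ne_top ha (PMF.apply_ne_top _ _)) (ENNReal.mul_ne_top hb (PMF.apply_ne_top _ _))
    (π₁ h x) (π₂ h x)
  have hplay : ∀ t, IsMixture a b (historyLaw init π t) (historyLaw init π₁ t)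
      (historyLaw init π₂ t) → IsMixture a b ((historyLaw init π t).bind (playSlot π))
        ((historyLaw init π₁ t).bind (playSlot π₁)) ((historyLaw init π₂ t).bind (playSlot π₂)) := by
    intro t ht
    refine IsMixture.bind_of_joint fun hx r => ?_
    have hact : ∀ act, historyLaw init π t hx * π hx.1 hx.2 act =
        a * (historyLaw init π₁ t hx * π₁ hx.1 hx.2 act) +
          b * (historyLaw init π₂ t hx * π₂ hx.1 hx.2 act) := by
      intro act
      rw [ht hx]
      by_cases hl : hx.1.length = t
      · subst hl
        rw [hπ hx.1 hx.2 act, mul_assoc, mul_assoc]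
      · have h1 : historyLaw init π₁ t hx = 0 := by
          by_contra h; exact hl (length_of_historyLaw_ne_zero h)
        have h2 : historyLaw init π₂ t hx = 0 := by
          by_contra h; exact hl (length_of_historyLaw_ne_zero h)
        simp [h1, h2]
    simp only [playSlot, PMF.bind_apply, ← ENNReal.tsum_mul_left]
    rw [← ENNReal.tsum_add]
    refine tsum_congr fun act => ?_
    rw [← mul_assoc, hact act]
    ring
  have hhist : ∀ t, IsMixture a b (historyLaw init π t) (historyLaw init π₁ t)
      (historyLaw init π₂ t) := by
    intro t
    induction t with
    | zero => exact IsMixture.self hab _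
    | succ t ih => exact (hplay t ih).bind _
  exact ⟨π, fun t => (hplay t (hhist t)).map _⟩

theorem tendsto_average_mix {u u₁ u₂ : ℕ → ℝ} {a b L₁ L₂ : ℝ} (h : ∀ t, u t = a * u₁ t + b * u₂ t)
    (h₁ : Tendsto (fun T : ℕ => (1 / (T : ℝ)) * ∑ t ∈ Finset.Icc 1 T, u₁ t) atTop (𝓝 L₁))
    (h₂ : Tendsto (fun T : ℕ => (1 / (T : ℝ)) * ∑ t ∈ Finset.Icc 1 T, u₂ t) atTop (𝓝 L₂)) :
    Tendsto (fun T : ℕ => (1 / (T : ℝ)) * ∑ t ∈ Finset.Icc 1 T, u t) atTop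
      (𝓝 (a * L₁ + b * L₂)) := by
  refine ((h₁.const_mul a).add (h₂.const_mul b)).congr fun T => ?_
  simp only [h, Finset.sum_add_distrib, ← Finset.mul_sum]
  ring

theorem Achieves.mix {π₁ π₂ : M.Policy D} {x₁ x₂ : Fin N → ℝ} {E₁ E₂ a b : ℝ} (ha : 0 ≤ a)
    (hb : 0 ≤ b) (hab : a + b = 1) (h₁ : Achieves init π₁ x₁ E₁) (h₂ : Achieves init π₂ x₂ E₂) :
    ∃ π, Achieves init π (fun n => a * x₁ n + b * x₂ n) (a * E₁ + b * E₂) := by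
  have hab' : ENNReal.ofReal a + ENNReal.ofReal b = 1 := by
    rw [← ENNReal.ofReal_add ha hb, hab, ENNReal.ofReal_one]
  obtain ⟨π, hπ⟩ := exists_mixed_policy _ _ hab' init π₁ π₂
  have hmean : ∀ {f : M.Step D → ℝ}, IsBdd f → ∀ t, pmfMean (slotLaw init π t) f =
      a * pmfMean (slotLaw init π₁ t) f + b * pmfMean (slotLaw init π₂ t) f := by
    intro f hf t
    rw [(hπ t).mean hab' hf, ENNReal.toReal_ofReal ha, ENNReal.toReal_ofReal hb]
  exact ⟨π, fun n => tendsto_average_mix (hmean (isBdd_deliveries n)) (h₁.throughput n)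
    (h₂.throughput n), tendsto_average_mix (hmean isBdd_totalConsumption) h₁.expenditure
    h₂.expenditure⟩

/-- The achievable pairs of weighted throughput and expenditure. -/
def achievable (init : PMF (M.State D)) : Set (ℝ × ℝ) :=
  {s | ∃ (π : M.Policy D) (x : Fin N → ℝ), Achieves init π x s.2 ∧ s.1 = ∑ n, M.β n * x n}

theorem convex_achievable : Convex ℝ (achievable init) := by
  rintro ⟨_, E₁⟩ ⟨π₁, x₁, h₁, rfl⟩ ⟨_, E₂⟩ ⟨π₂, x₂, h₂, rfl⟩ a b ha hb hab
  obtain ⟨π, hπ⟩ := h₁.mix ha hb hab h₂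
  refine ⟨π, _, hπ, ?_⟩
  simp only [Prod.smul_mk, Prod.mk_add_mk, smul_eq_mul, Finset.mul_sum, ← Finset.sum_add_distrib]
  exact Finset.sum_congr rfl fun n _ => by ring

end PredictiveSystem

/-- Lagrangian duality for one constraint, under Slater's condition. -/
theorem exists_multiplier {S : Set (ℝ × ℝ)} (hS : Convex ℝ S) {B φ : ℝ}
    (hslater : ∃ s ∈ S, s.2 < B) (hφ : ∀ s ∈ S, s.2 ≤ B → s.1 ≤ φ) :
    ∃ lam : ℝ, 0 ≤ lam ∧ ∀ s ∈ S, s.1 - lam * s.2 ≤ φ - lam * B := by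
  -- No point of `S` has expenditure below `B` and value above `φ`, so a functional separates `S`
  -- from this open quadrant.
  obtain ⟨f, u, hf, hu⟩ := geometric_hahn_banach_open (s := Set.Ioi φ ×ˢ Set.Iio B) (t := S)
    ((convex_Ioi φ).prod (convex_Iio B)) (isOpen_Ioi.prod isOpen_Iio) hS
    (Set.disjoint_left.2 fun s hs hsS => (hφ s hsS hs.2.le).not_gt hs.1)
  set p := f (1, 0)
  set q := f (0, 1)
  have hlin : ∀ v w : ℝ, f (v, w) = v * p + w * q := by
    intro v w
    have : ((v, w) : ℝ × ℝ) = v • (1, 0) + w • (0, 1) := by simp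
    rw [this, map_add, map_smul, map_smul]
    rfl
  have hopen : ∀ r s : ℝ, 0 < r → 0 < s → (φ + r) * p + (B - s) * q < u := fun r s hr hs => by
    rw [← hlin]
    exact hf _ ⟨by simpa using hr, by simpa using hs⟩
  have hp : p ≤ 0 := by
    by_contra! h
    -- A displacement so large that, were `p` positive, the functional would exceed `u` inside the
    -- quadrant.
    have h1 := hopen (1 + |u - (φ * p + (B - 1) * q)| / p) 1 (by positivity) one_pos
    have h2 := le_abs_self (u - (φ * p + (B - 1) * q))
    have h3 : |u - (φ * p + (B - 1) * q)| / p * p = |u - (φ * p + (B - 1) * q)| :=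
      div_mul_cancel₀ _ h.ne'
    nlinarith
  have hq : 0 ≤ q := by
    by_contra! h
    have h1 := hopen 1 (1 + |u - ((φ + 1) * p + B * q)| / (-q)) one_pos
      (by have := neg_pos.2 h; positivity)
    have h2 := le_abs_self (u - ((φ + 1) * p + B * q))
    have h3 : |u - ((φ + 1) * p + B * q)| / (-q) * (-q) = |u - ((φ + 1) * p + B * q)| :=
      div_mul_cancel₀ _ (neg_pos.2 h).ne'
    nlinarith
  have hclosed : φ * p + B * q ≤ u := by
    have h1 : Tendsto (fun r : ℝ => (φ + r) * p + (B - r) * q) (𝓝[>] 0)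
        (𝓝 ((φ + 0) * p + (B - 0) * q)) :=
      Tendsto.mono_left (Continuous.tendsto (by fun_prop) 0) nhdsWithin_le_nhds
    rw [add_zero, sub_zero] at h1
    refine le_of_tendsto h1 ?_
    filter_upwards [self_mem_nhdsWithin] with r hr
    exact (hopen r r hr hr).le
  have hSq : ∀ s ∈ S, φ * p + B * q ≤ s.1 * p + s.2 * q := fun s hs =>
    (hclosed.trans (hu s hs)).trans_eq (hlin s.1 s.2)
  -- With `p = 0` the separation would force every expenditure in `S` up to at least `B`, against
  -- Slater's condition.
  have hp' : p < 0 := by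
    refine hp.lt_of_ne fun h0 => ?_
    obtain ⟨s, hs, hsB⟩ := hslater
    have h1 := hSq s hs
    have h2 := ((hopen 1 1 one_pos one_pos).trans_le (hu s hs)).trans_eq (hlin s.1 s.2)
    rw [h0, mul_zero, mul_zero, zero_add, zero_add] at h1 h2
    rcases hq.eq_or_lt with h | h
    · simp [← h] at h2
    · exact (h1.trans_lt (mul_lt_mul_of_pos_right hsB h)).false
  refine ⟨q / (-p), div_nonneg hq (neg_nonneg.2 hp), fun s hs => ?_⟩
  have h1 := hSq s hs
  have h2 : q / (-p) * (-p) = q := div_mul_cancel₀ _ (neg_pos.2 hp').ne'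
  set l := q / (-p)
  have h3 : (s.1 - l * s.2) * (-p) ≤ (φ - l * B) * (-p) := by
    linear_combination h1 + (B - s.2) * h2
  exact le_of_mul_le_mul_right h3 (neg_pos.2 hp')

namespace PredictiveSystem

variable {N K : ℕ} {M : PredictiveSystem N K} {D : Fin N → ℕ}

/-! ### Bounds for the optimal throughput -/

theorem optimalThroughput_le_gu (init : PMF (M.State D)) {lam : ℝ} (hlam : 0 ≤ lam) :
    optimalThroughput init ≤ M.gu D lam := by
  refine csSup_le ?_ ?_
  · obtain ⟨π, x, h⟩ := exists_achieves_zero (init := init)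
    exact ⟨_, π, x, 0, h, M.budget_pos.le, rfl⟩
  · rintro _ ⟨π, x, Eav, h, hE, rfl⟩
    exact h.le_gu hlam hE

theorem gl_le_optimalThroughput (init : PMF (M.State D)) {lam : ℝ}
    (hmin : IsMinOn (M.gl D) (Set.Ici 0) lam) : M.gl D lam ≤ optimalThroughput init := by
  obtain ⟨l, hl, hdual⟩ := exists_multiplier (convex_achievable (init := init)) (B := M.budget)
    (φ := optimalThroughput init)
    (by
      obtain ⟨π, x, h⟩ := exists_achieves_zero (init := init)
      exact ⟨(_, 0), ⟨π, x, h, rfl⟩, M.budget_pos⟩)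
    (by
      rintro ⟨_, E⟩ ⟨π, x, h, rfl⟩ hE
      -- Weak duality at price 0 bounds the throughputs, so the supremum is genuine.
      refine le_csSup ⟨M.gu D 0, ?_⟩ ⟨π, x, E, h, hE, rfl⟩
      rintro _ ⟨π, x, Eav, h, hE, rfl⟩
      exact h.le_gu le_rfl hE)
  -- Minimality replaces `lam` by the multiplier `l`, the price at which strong duality holds.
  refine (isMinOn_iff.1 hmin l hl).trans (le_of_forall_pos_le_add fun δ hδ => ?_)
  obtain ⟨σ, hσ⟩ := exists_stationary_ge_gl (init := init) hl hδ
  obtain ⟨x, Eav, h⟩ := exists_achieves_stationary (init := init) σ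
  have h1 := hσ x Eav h
  have h2 : ∑ n, M.β n * x n - l * Eav ≤ optimalThroughput init - l * M.budget :=
    hdual (_, Eav) ⟨_, x, h, rfl⟩
  linarith

/-! ### Specialization to empty windows -/

variable (M)

theorem arrivalRate_eq (n : Fin N) : M.arrivalRate n =
    M.predictedRate n * M.p n + (M.Amax - M.predictedRate n) * M.q n := by
  have h : M.p n - M.q n ≠ 0 := sub_ne_zero.2 (M.q_lt_p n).ne'
  have h1 : M.predictedRate n * (M.p n - M.q n) = M.arrivalRate n - M.Amax * M.q n :=
    div_mul_cancel₀ _ h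
  linarith

theorem VlPred_deadline (n : Fin N) (lam : ℝ) :
    M.VlPred n lam (M.deadline n) = M.p n * M.Vl n lam (M.deadline n) := by
  rw [VlPred, if_neg (lt_irrefl _), Vl, maxPosLevel, maxPosLevel, ← smul_eq_mul (M.p n),
    ← Real.sSup_smul_of_nonneg (M.p_nonneg n), ← Set.image_smul, Set.image_image]
  congr 1
  refine Set.image_congr fun e _ => ?_
  simp
  ring

/-- Without a window, predicted and unpredicted packets are worth `p` and `q` times the same bound,
and these weights add up to the arrival rate. -/
theorem gl_zero : M.gl 0 = M.g0l := by
  funext lam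
  rw [gl, g0l]
  congr 1
  refine Finset.sum_congr rfl fun n _ => ?_
  rw [Pi.zero_apply, add_zero, max_self, VlPred_deadline, arrivalRate_eq,
    ← mul_zero (M.p n), ← mul_max_of_nonneg _ _ (M.p_nonneg n), mul_zero]
  ring

theorem gu_zero : M.gu 0 = M.g0u := by
  funext lam
  rw [gu, g0u]
  congr 1
  refine Finset.sum_congr rfl fun n _ => ?_
  rw [Pi.zero_apply, add_zero, VuPred_deadline, arrivalRate_eq,
    ← mul_min_of_nonneg _ _ (M.p_nonneg n)]
  ring

end PredictiveSystem

end

theorem mainTheorem10 {N K : ℕ} (M : PredictiveSystem N K)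
    (init₀ : PMF (M.State 0)) (initI : PMF (M.State M.window))
    (lam₀ lamI : ℝ)
    (hlam₀ : 0 ≤ lam₀ ∧ IsMinOn M.g0l (Set.Ici 0) lam₀)
    (hlamI : 0 ≤ lamI ∧ IsMinOn M.gIl (Set.Ici 0) lamI) :
    M.gIl lamI - M.g0u lamI ≤
        PredictiveSystem.optimalThroughput initI - PredictiveSystem.optimalThroughput init₀ ∧
      PredictiveSystem.optimalThroughput initI - PredictiveSystem.optimalThroughput init₀ ≤
        M.gIu lam₀ - M.g0l lam₀ := by
  have hI := PredictiveSystem.gl_le_optimalThroughput initI (lam := lamI) hlamI.2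
  have hI' := PredictiveSystem.optimalThroughput_le_gu initI hlam₀.1
  have h0 := PredictiveSystem.gl_le_optimalThroughput init₀ (lam := lam₀) (by
    rw [M.gl_zero]; exact hlam₀.2)
  have h0' := PredictiveSystem.optimalThroughput_le_gu init₀ hlamI.1
  rw [M.gl_zero] at h0
  rw [M.gu_zero] at h0'
  exact ⟨sub_le_sub hI h0', sub_le_sub hI' h0⟩
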